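/- Let ${}_3F_2(a_1,a_2,a_3;b_1,b_2\,|\,z)=\sum_{n\ge 0}\frac{(a_1)_n(a_2)_n(a_3)_n}{(b_1)_n(b_2)_n\,n!}z^n$, and define $$\Psi_4(x)=\frac{x\,(2x^2-21x+56)^2\,(x^2-28)^4\,(x^2-7x+14)^4}{4\,(x^3-14x^2+56x-56)^7},$$ $$P_4=1-x+\tfrac14x^2-\tfrac1{56}x^3,\qquad Q_4=\left(1-\tfrac1{28}x^2\right)\left(1-\tfrac12x+\tfrac1{14}x^2\right),$$ $$Q_8=\left(1+3x-\tfrac94x^2+\tfrac12x^3-\tfrac1{28}x^4\right)\left(1-\tfrac58x+\tfrac3{16}x^2-\tfrac1{32}x^3+\tfrac1{448}x^4\right),$$ $$R_1=1-\tfrac38x+\tfrac1{28}x^2,\qquad R_2=1-\tfrac{33}{32}x+\tfrac{13}{32}x^2-\tfrac9{128}x^3+\tfrac1{224}x^4,$$ $$K_1=\left(\tfrac12\sqrt{R_1R_2}+\tfrac12-\tfrac{45}{128}x+\tfrac5{64}x^2-\tfrac5{896}x^3\right)^{1/4},\qquad K_2=\left(\frac{\sqrt{R_1R_2}-1+\frac{45}{64}x-\frac5{32}x^2+\frac5{448}x^3}{\frac{625}{57344}x^2}\right)^{1/4},$$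 where all roots and fractional powers are principal (equal to $1$ at $x=0$), and $K_2$ is given its limit value $1$ at the removable singularity $x=0$. **Theorem.** (i) Wherever $P_4\ne0$, $$\Psi_4=-\frac{343\,x\,R_1^2\,Q_4^4}{32\,P_4^7}=1-\frac{R_2\,Q_8^2}{P_4^7}.$$ (ii) $K_1$ and $K_2$ are analytic at $x=0$ with value $1$, and for all complex $x$ in a neighborhood of $0$ the following three hypergeometric series converge and $${}_3F_2\!\left(-\tfrac1{28},\tfrac3{28},\tfrac{19}{28};\tfrac12,\tfrac34\,\Big|\,\Psi_4\right)=\frac{K_1}{P_4^{1/4}},$$ $${}_3F_2\!\left(\tfrac3{14},\tfrac5{14},\tfrac{13}{14};\tfrac34,\tfrac54\,\Big|\,\Psi_4\right)=\frac{P_4^{3/2}}{Q_4\sqrt{R_1}},$$ $${}_3F_2\!\left(\tfrac{13}{28},\tfrac{17}{28},\tfrac{33}{28};\tfrac54,\tfrac32\,\Big|\,\Psi_4\right)=\frac{P_4^{13/4}K_2}{Q_4^2R_1}.$$ (iii) There is a disc around $x=0$ such that $\Psi_4'$ has no zeros in it and, on every open subset of the punctured disc, every holomorphic branch of each of the three functions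 $$x^{1/4},\qquad \left(\pm\sqrt{R_1R_2}+1-\tfrac{45}{64}x+\tfrac5{32}x^2-\tfrac5{448}x^3\right)^{1/4}$$ satisfies the third-order linear differential equation for $Y$ obtained from the hypergeometric equation $$\left(z\tfrac d{dz}-\tfrac1{28}\right)\left(z\tfrac d{dz}+\tfrac3{28}\right)\left(z\tfrac d{dz}+\tfrac{19}{28}\right)y=\tfrac d{dz}\left(z\tfrac d{dz}-\tfrac12\right)\left(z\tfrac d{dz}-\tfrac14\right)y$$ by the pull-back $z=\Psi_4(x)$, $Y(x)=P_4(x)^{1/4}\,y(\Psi_4(x))$. -/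

import Mathlib

open Filter Topology

namespace Darboux

noncomputable section

/-- The `n`-th term `(a₁)ₙ (a₂)ₙ (a₃)ₙ / ((b₁)ₙ (b₂)ₙ n!) zⁿ` of the generalized hypergeometric
series `₃F₂(a₁, a₂, a₃; b₁, b₂ | z)`, with `(a)ₙ = a (a + 1) ⋯ (a + n - 1)`. -/
def hypTerm (a₁ a₂ a₃ b₁ b₂ z : ℂ) (n : ℕ) : ℂ :=
  ((ascPochhammer ℂ n).eval a₁ * (ascPochhammer ℂ n).eval a₂ * (ascPochhammer ℂ n).eval a₃) /
    ((ascPochhammer ℂ n).eval b₁ * (ascPochhammer ℂ n).eval b₂ * (n.factorial : ℂ)) * z ^ n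

/-- The generalized hypergeometric function `₃F₂(a₁, a₂, a₃; b₁, b₂ | z)`, as the sum of its
series. -/
def hyp (a₁ a₂ a₃ b₁ b₂ z : ℂ) : ℂ := ∑' n, hypTerm a₁ a₂ a₃ b₁ b₂ z n

/-- The operator `d/dz` written in the coordinate `x`, where `z = φ x`. -/
def pullD (φ f : ℂ → ℂ) : ℂ → ℂ := fun x => deriv f x / deriv φ x

/-- The operator `z d/dz + a` written in the coordinate `x`, where `z = φ x`. -/
def pullEuler (φ : ℂ → ℂ) (a : ℂ) (f : ℂ → ℂ) : ℂ → ℂ :=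
  fun x => φ x * pullD φ f x + a * f x

/-- `Y` satisfies, at the point `x`, the pull-back under `z = φ x`, `Y x = θ x * y (φ x)` of the
hypergeometric differential equation
`(z d/dz + a₁) (z d/dz + a₂) (z d/dz + a₃) y
  = d/dz (z d/dz + b₁ - 1) (z d/dz + b₂ - 1) y`. -/
def PulledBackHypEqAt (a₁ a₂ a₃ b₁ b₂ : ℂ) (φ θ Y : ℂ → ℂ) (x : ℂ) : Prop :=
  pullEuler φ a₁ (pullEuler φ a₂ (pullEuler φ a₃ (fun t => Y t / θ t))) x =
    pullD φ (pullEuler φ (b₁ - 1) (pullEuler φ (b₂ - 1) (fun t => Y t / θ t))) x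

/-- The covering of degree 21. -/
def Ψ₄ (x : ℂ) : ℂ :=
  (x * (2 * x ^ 2 - 21 * x + 56) ^ 2 * (x ^ 2 - 28) ^ 4 * (x ^ 2 - 7 * x + 14) ^ 4) /
    (4 * (x ^ 3 - 14 * x ^ 2 + 56 * x - 56) ^ 7)

def P₄ (x : ℂ) : ℂ := 1 - x + 1 / 4 * x ^ 2 - 1 / 56 * x ^ 3

def Q₄ (x : ℂ) : ℂ := (1 - 1 / 28 * x ^ 2) * (1 - 1 / 2 * x + 1 / 14 * x ^ 2)

def Q₈ (x : ℂ) : ℂ :=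
  (1 + 3 * x - 9 / 4 * x ^ 2 + 1 / 2 * x ^ 3 - 1 / 28 * x ^ 4) *
    (1 - 5 / 8 * x + 3 / 16 * x ^ 2 - 1 / 32 * x ^ 3 + 1 / 448 * x ^ 4)

def R₁ (x : ℂ) : ℂ := 1 - 3 / 8 * x + 1 / 28 * x ^ 2

def R₂ (x : ℂ) : ℂ :=
  1 - 33 / 32 * x + 13 / 32 * x ^ 2 - 9 / 128 * x ^ 3 + 1 / 224 * x ^ 4

/-- The square root of `R₁ R₂` that equals `1` at `x = 0`. -/
def sqrtR (x : ℂ) : ℂ := (R₁ x * R₂ x) ^ (1 / 2 : ℂ)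

/-- The fourth root, with value `1` at `x = 0`. -/
def K₁ (x : ℂ) : ℂ :=
  (1 / 2 * sqrtR x + 1 / 2 - 45 / 128 * x + 5 / 64 * x ^ 2 - 5 / 896 * x ^ 3) ^ (1 / 4 : ℂ)

open Classical in
/-- The defining quotient has a removable singularity at `x = 0`, where its value is `1`. -/
def K₂ (x : ℂ) : ℂ :=
  if x = 0 then 1
  else ((sqrtR x - 1 + 45 / 64 * x - 5 / 32 * x ^ 2 + 5 / 448 * x ^ 3) /
    (625 / 57344 * x ^ 2)) ^ (1 / 4 : ℂ)

end

end Darboux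

open Darboux

/-!
The three functions `Y` in the theorem are fourth roots, so `logDeriv Y = logDeriv (Y ^ 4) / 4` does
not depend on a branch, and it lies in the field `ℂ(x, √(R₁ R₂))`. The pulled-back equation divided
by `Y` is a Riccati equation for this logarithmic derivative, and hence an identity in that field.
For `Y ^ 4 = x` it is an identity between rational functions; for
`Y ^ 4 = ±√(R₁ R₂) + 1 - 45 / 64 * x + ⋯` it splits into two of them, the coefficients of `1` and
of `√(R₁ R₂)`.

The fourth powers of the three evaluations are, up to constants, these quartic expressions divided
by `P₄`, `P₄ Ψ₄` and `P₄ Ψ₄²`. The factors `Ψ₄ ^ (-1 / 4)` and `Ψ₄ ^ (-1 / 2)` move the local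
exponents `1 / 4` and `1 / 2` of the hypergeometric equation to `0`, turning it into the equations
of the second and third series. Since `Ψ₄` has a simple zero at `0`, each evaluation is an analytic
function of `z = Ψ₄ x`, with value `1` at `z = 0`, and its hypergeometric equation is a recursion
that determines its Taylor coefficients.
-/

namespace Darboux

section Preliminaries

theorem ascPochhammer_eval_ne_zero {R : Type*} [CommRing R] [IsDomain R] {b : R}
    (hb : ∀ n : ℕ, b + n ≠ 0) (n : ℕ) : (ascPochhammer R n).eval b ≠ 0 := by
  induction n with
  | zero => simp
  | succ n ih => rw [ascPochhammer_succ_eval]; exact mul_ne_zero ih (hb n)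

theorem ofReal_add_natCast_ne_zero {q : ℝ} (hq : 0 < q) (n : ℕ) : (q : ℂ) + n ≠ 0 := by
  have hpos : 0 < q + n := by positivity
  exact_mod_cast hpos.ne'

theorem cpow_natCast_div_pow (z : ℂ) (n : ℕ) {m : ℕ} (hm : m ≠ 0) :
    (z ^ (n / m : ℂ)) ^ m = z ^ n := by
  rw [← Complex.cpow_nat_mul, mul_div_cancel₀ _ (Nat.cast_ne_zero.2 hm), Complex.cpow_natCast]

theorem eventually_mem_slitPlane {X : Type*} [TopologicalSpace X] {G : X → ℂ} {x : X}
    (hG : ContinuousAt G x) (h : G x ∈ Complex.slitPlane) :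
    ∀ᶠ y in 𝓝 x, G y ∈ Complex.slitPlane :=
  hG.eventually_mem (Complex.isOpen_slitPlane.mem_nhds h)

variable {𝕜 : Type*} [NontriviallyNormedField 𝕜] {x : 𝕜}

theorem hasDerivAt_const_div_id_pow (c : 𝕜) (n : ℕ) (h0 : x ≠ 0) :
    HasDerivAt (fun y : 𝕜 => c / y ^ n) (-(n * c) / x ^ (n + 1)) x := by
  refine ((hasDerivAt_const x c).fun_div (hasDerivAt_pow n x) (pow_ne_zero n h0)).congr_deriv ?_
  rcases n with _ | n
  · simp
  · simp only [Nat.add_sub_cancel]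
    field_simp
    ring

theorem hasDerivAt_const_div_sub_pow (c a : 𝕜) (n : ℕ) (h : a - x ≠ 0) :
    HasDerivAt (fun y : 𝕜 => c / (a - y) ^ n) (n * c / (a - x) ^ (n + 1)) x := by
  refine ((hasDerivAt_const_div_id_pow c n h).comp x
    ((hasDerivAt_id' x).const_sub a)).congr_deriv ?_
  ring

theorem natCast_mul_logDeriv_of_pow_eq {f G : 𝕜 → 𝕜} {n : ℕ} {κ : 𝕜}
    (hf : DifferentiableAt 𝕜 f x) (hκ : κ ≠ 0) (h : ∀ᶠ y in 𝓝 x, f y ^ n = κ * G y) :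
    n * logDeriv f x = logDeriv G x := by
  rw [← logDeriv_fun_pow hf n, (logDeriv_congr_nhds h).eq_of_nhds, logDeriv_const_mul x κ hκ]

end Preliminaries

section HypergeometricSeries

/-- The operator `z d/dz + a`, that is, `pullEuler` in the coordinate `z` itself. -/
noncomputable def eulerOp (a : ℂ) (g : ℂ → ℂ) : ℂ → ℂ := fun z => z * deriv g z + a * g z

theorem analyticAt_eulerOp {g : ℂ → ℂ} {z : ℂ} (hg : AnalyticAt ℂ g z) (a : ℂ) :
    AnalyticAt ℂ (eulerOp a g) z := by
  unfold eulerOp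
  fun_prop

theorem iteratedDeriv_id_mul_deriv_zero (n : ℕ) {g : ℂ → ℂ} (hg : AnalyticAt ℂ g 0) :
    iteratedDeriv n (fun z => z * deriv g z) 0 = n * iteratedDeriv n g 0 := by
  induction n generalizing g with
  | zero => simp
  | succ n ih =>
    have hderiv : deriv (fun z => z * deriv g z) =ᶠ[𝓝 0]
        deriv g + fun z => z * deriv (deriv g) z := by
      filter_upwards [hg.eventually_analyticAt] with z hz
      simpa using ((hasDerivAt_id' z).fun_mul hz.deriv.differentiableAt.hasDerivAt).deriv
    have hanalytic : AnalyticAt ℂ (fun z => z * deriv (deriv g) z) 0 :=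
      analyticAt_id.mul hg.deriv.deriv
    rw [iteratedDeriv_succ', hderiv.iteratedDeriv_eq, iteratedDeriv_add hg.deriv.contDiffAt
      hanalytic.contDiffAt, ih hg.deriv, iteratedDeriv_succ']
    push_cast
    ring

theorem iteratedDeriv_eulerOp_zero (n : ℕ) (a : ℂ) {g : ℂ → ℂ} (hg : AnalyticAt ℂ g 0) :
    iteratedDeriv n (eulerOp a g) 0 = (n + a) * iteratedDeriv n g 0 := by
  have hsum := iteratedDeriv_fun_add (n := n) (f := fun z => z * deriv g z)
    (g := fun z => a * g z) (x := (0 : ℂ)) (analyticAt_id.mul hg.deriv).contDiffAt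
    (analyticAt_const.mul hg).contDiffAt
  unfold eulerOp
  rw [hsum, iteratedDeriv_id_mul_deriv_zero n hg,
    iteratedDeriv_const_mul _ hg.contDiffAt, add_mul]

variable {a₁ a₂ a₃ b₁ b₂ : ℂ}

theorem iteratedDeriv_succ_of_eulerOp {g : ℂ → ℂ} (hg : AnalyticAt ℂ g 0)
    (h : eulerOp a₁ (eulerOp a₂ (eulerOp a₃ g)) =ᶠ[𝓝 0]
      deriv (eulerOp (b₁ - 1) (eulerOp (b₂ - 1) g))) (n : ℕ) :
    (b₁ + n) * (b₂ + n) * iteratedDeriv (n + 1) g 0 =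
      (a₁ + n) * (a₂ + n) * (a₃ + n) * iteratedDeriv n g 0 := by
  have hcoeff := h.iteratedDeriv_eq n
  have hE (a : ℂ) := analyticAt_eulerOp hg a
  rw [← iteratedDeriv_succ', iteratedDeriv_eulerOp_zero _ _ (analyticAt_eulerOp (hE _) _),
    iteratedDeriv_eulerOp_zero _ _ (hE _), iteratedDeriv_eulerOp_zero _ _ hg,
    iteratedDeriv_eulerOp_zero _ _ (hE _), iteratedDeriv_eulerOp_zero _ _ hg] at hcoeff
  push_cast at hcoeff
  linear_combination -hcoeff

theorem iteratedDeriv_of_eulerOp (hb₁ : ∀ n : ℕ, b₁ + n ≠ 0) (hb₂ : ∀ n : ℕ, b₂ + n ≠ 0)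
    {g : ℂ → ℂ} (hg : AnalyticAt ℂ g 0) (hg0 : g 0 = 1)
    (h : eulerOp a₁ (eulerOp a₂ (eulerOp a₃ g)) =ᶠ[𝓝 0]
      deriv (eulerOp (b₁ - 1) (eulerOp (b₂ - 1) g))) (n : ℕ) :
    iteratedDeriv n g 0 =
      ((ascPochhammer ℂ n).eval a₁ * (ascPochhammer ℂ n).eval a₂ * (ascPochhammer ℂ n).eval a₃) /
        ((ascPochhammer ℂ n).eval b₁ * (ascPochhammer ℂ n).eval b₂) := by
  induction n with
  | zero => simp [hg0]
  | succ n ih =>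
    have hp₁ := ascPochhammer_eval_ne_zero hb₁ n
    have hp₂ := ascPochhammer_eval_ne_zero hb₂ n
    have hn₁ := hb₁ n
    have hn₂ := hb₂ n
    have hrec := iteratedDeriv_succ_of_eulerOp hg h n
    rw [ih] at hrec
    simp only [ascPochhammer_succ_eval]
    field_simp at hrec ⊢
    linear_combination hrec

theorem hasSum_hypTerm_of_eulerOp (hb₁ : ∀ n : ℕ, b₁ + n ≠ 0) (hb₂ : ∀ n : ℕ, b₂ + n ≠ 0)
    {g : ℂ → ℂ} (hg : AnalyticAt ℂ g 0) (hg0 : g 0 = 1)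
    (h : eulerOp a₁ (eulerOp a₂ (eulerOp a₃ g)) =ᶠ[𝓝 0]
      deriv (eulerOp (b₁ - 1) (eulerOp (b₂ - 1) g))) :
    ∀ᶠ z in 𝓝 (0 : ℂ), HasSum (hypTerm a₁ a₂ a₃ b₁ b₂ z) (g z) := by
  have htaylor := hg.hasFPowerSeriesAt
  rw [hasFPowerSeriesAt_iff] at htaylor
  filter_upwards [htaylor] with z hz
  rw [zero_add] at hz
  refine hz.congr_fun fun n => ?_
  rw [FormalMultilinearSeries.coeff_ofScalars, iteratedDeriv_of_eulerOp hb₁ hb₂ hg hg0 h,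
    hypTerm, smul_eq_mul, div_div, mul_comm]

theorem pullD_eventuallyEq_comp {φ f g : ℂ → ℂ} {x : ℂ} (hφ : AnalyticAt ℂ φ x)
    (hφ' : deriv φ x ≠ 0) (hg : AnalyticAt ℂ g (φ x)) (h : f =ᶠ[𝓝 x] g ∘ φ) :
    pullD φ f =ᶠ[𝓝 x] deriv g ∘ φ := by
  filter_upwards [h.eventuallyEq_nhds, hφ.eventually_analyticAt,
    hφ.continuousAt.eventually hg.eventually_analyticAt,
    hφ.deriv.continuousAt.eventually_ne hφ'] with y hfg hφy hgy hφ'y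
  rw [pullD, hfg.deriv_eq, deriv_comp _ hgy.differentiableAt hφy.differentiableAt,
    mul_div_cancel_right₀ _ hφ'y, Function.comp_apply]

theorem pullEuler_eventuallyEq_comp {φ f g : ℂ → ℂ} {x : ℂ} (a : ℂ) (hφ : AnalyticAt ℂ φ x)
    (hφ' : deriv φ x ≠ 0) (hg : AnalyticAt ℂ g (φ x)) (h : f =ᶠ[𝓝 x] g ∘ φ) :
    pullEuler φ a f =ᶠ[𝓝 x] eulerOp a g ∘ φ := by
  filter_upwards [h, pullD_eventuallyEq_comp hφ hφ' hg h] with y hfg hD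
  simp only [pullEuler, eulerOp, hfg, hD, Function.comp_apply]

theorem eventually_eulerOp_comp_eq {φ f g : ℂ → ℂ} (hφ : AnalyticAt ℂ φ 0)
    (hφ' : deriv φ 0 ≠ 0) (hg : AnalyticAt ℂ g (φ 0)) (hfg : f =ᶠ[𝓝 0] g ∘ φ)
    (h : ∀ᶠ x in 𝓝[≠] 0, PulledBackHypEqAt a₁ a₂ a₃ b₁ b₂ φ (fun _ => 1) f x) :
    eulerOp a₁ (eulerOp a₂ (eulerOp a₃ g)) ∘ φ =ᶠ[𝓝 0]
      deriv (eulerOp (b₁ - 1) (eulerOp (b₂ - 1) g)) ∘ φ := by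
  have hfg' : (fun x => f x / 1) =ᶠ[𝓝 0] g ∘ φ := by simpa only [div_one] using hfg
  have hE (a : ℂ) := analyticAt_eulerOp hg a
  have hEE (a b : ℂ) := analyticAt_eulerOp (hE a) b
  have hpull (a : ℂ) := pullEuler_eventuallyEq_comp a hφ hφ' hg hfg'
  have hleft := pullEuler_eventuallyEq_comp a₁ hφ hφ' (hEE a₃ a₂)
    (pullEuler_eventuallyEq_comp a₂ hφ hφ' (hE a₃) (hpull a₃))
  have hright := pullD_eventuallyEq_comp hφ hφ' (hEE (b₂ - 1) (b₁ - 1))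
    (pullEuler_eventuallyEq_comp (b₁ - 1) hφ hφ' (hE (b₂ - 1)) (hpull (b₂ - 1)))
  refine (((analyticAt_eulerOp (hEE a₃ a₂) a₁).comp hφ).frequently_eq_iff_eventually_eq
    ((hEE (b₂ - 1) (b₁ - 1)).deriv.comp hφ)).1 (Eventually.frequently ?_)
  filter_upwards [h, hleft.filter_mono nhdsWithin_le_nhds, hright.filter_mono nhdsWithin_le_nhds]
    with x hx hxl hxr
  exact hxl.symm.trans (hx.trans hxr)

theorem hasSum_hypTerm_of_pulledBackHypEqAt (hb₁ : ∀ n : ℕ, b₁ + n ≠ 0)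
    (hb₂ : ∀ n : ℕ, b₂ + n ≠ 0) {φ f : ℂ → ℂ} (hφ : AnalyticAt ℂ φ 0) (hφ0 : φ 0 = 0)
    (hφ' : deriv φ 0 ≠ 0) (hf : AnalyticAt ℂ f 0) (hf0 : f 0 = 1)
    (h : ∀ᶠ x in 𝓝[≠] 0, PulledBackHypEqAt a₁ a₂ a₃ b₁ b₂ φ (fun _ => 1) f x) :
    ∀ᶠ x in 𝓝 (0 : ℂ), HasSum (hypTerm a₁ a₂ a₃ b₁ b₂ (φ x)) (f x) := by
  set ψ := hφ.hasStrictDerivAt.localInverse _ _ _ hφ'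
  have hψ : AnalyticAt ℂ ψ (φ 0) := hφ.analyticAt_localInverse hφ'
  have hψ0 : ψ (φ 0) = 0 := HasStrictFDerivAt.localInverse_apply_image ..
  have hright : ∀ᶠ z in 𝓝 (φ 0), φ (ψ z) = z := HasStrictDerivAt.eventually_right_inverse ..
  have hleft : ∀ᶠ x in 𝓝 0, ψ (φ x) = x := HasStrictDerivAt.eventually_left_inverse ..
  have hg : AnalyticAt ℂ (f ∘ ψ) (φ 0) := AnalyticAt.comp (by rwa [hψ0]) hψ
  have hfg : f =ᶠ[𝓝 0] (f ∘ ψ) ∘ φ := by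
    filter_upwards [hleft] with x hx
    simp only [Function.comp_apply, hx]
  have hψ_tendsto : Tendsto ψ (𝓝 (φ 0)) (𝓝 0) := by
    simpa only [hψ0] using hψ.continuousAt.tendsto
  have hode : eulerOp a₁ (eulerOp a₂ (eulerOp a₃ (f ∘ ψ))) =ᶠ[𝓝 (φ 0)]
      deriv (eulerOp (b₁ - 1) (eulerOp (b₂ - 1) (f ∘ ψ))) := by
    filter_upwards [hψ_tendsto.eventually (eventually_eulerOp_comp_eq hφ hφ' hg hfg h), hright]
      with z hz hφψ
    simpa only [Function.comp_apply, hφψ] using hz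
  have hg0 : (f ∘ ψ) 0 = 1 := by rw [Function.comp_apply, ← hφ0, hψ0, hf0]
  rw [hφ0] at hg hode
  have hsum : ∀ᶠ z in 𝓝 (φ 0), HasSum (hypTerm a₁ a₂ a₃ b₁ b₂ z) ((f ∘ ψ) z) := by
    simpa only [hφ0] using hasSum_hypTerm_of_eulerOp hb₁ hb₂ hg hg0 hode
  filter_upwards [hφ.continuousAt.eventually hsum, hleft] with x hx hψφ
  simpa only [Function.comp_apply, hψφ] using hx

end HypergeometricSeries

section RiccatiForm

/-- The hypergeometric equation in `z` for the logarithmic derivative `l = δy / y`, where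
`δ = z d/dz`, `l₁ = δl` and `l₂ = δδl`. -/
def HypRiccati (a₁ a₂ a₃ b₁ b₂ z l l₁ l₂ : ℂ) : Prop :=
  z * (l₂ + l₁ * (3 * l + a₁ + a₂ + a₃) + (l + a₁) * (l + a₂) * (l + a₃)) =
    l₂ + l₁ * (3 * l + (b₁ - 1) + (b₂ - 1)) + l * (l + (b₁ - 1)) * (l + (b₂ - 1))

variable {a₁ a₂ a₃ b₁ b₂ z l l₁ l₂ : ℂ}

theorem HypRiccati.shift_left (h : HypRiccati a₁ a₂ a₃ b₁ b₂ z l l₁ l₂) :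
    HypRiccati (a₁ + 1 - b₁) (a₂ + 1 - b₁) (a₃ + 1 - b₁) (b₂ + 1 - b₁) (2 - b₁) z
      (l - (1 - b₁)) l₁ l₂ := by
  unfold HypRiccati at *
  linear_combination h

theorem HypRiccati.shift_right (h : HypRiccati a₁ a₂ a₃ b₁ b₂ z l l₁ l₂) :
    HypRiccati (a₁ + 1 - b₂) (a₂ + 1 - b₂) (a₃ + 1 - b₂) (b₁ + 1 - b₂) (2 - b₂) z
      (l - (1 - b₂)) l₁ l₂ := by
  unfold HypRiccati at *
  linear_combination h

variable {φ f μ : ℂ → ℂ} {x : ℂ}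

theorem pullEuler_mul (a : ℂ) (hf : DifferentiableAt ℂ f x) (hμ : DifferentiableAt ℂ μ x) :
    pullEuler φ a (fun t => f t * μ t) x =
      pullEuler φ 0 f x * μ x + f x * pullEuler φ a μ x := by
  simp only [pullEuler, pullD, deriv_fun_mul hf hμ]
  ring

theorem pullD_eq_pullEuler_zero_div (hφ : φ x ≠ 0) : pullD φ f x = pullEuler φ 0 f x / φ x := by
  rw [pullEuler]
  field_simp
  ring

theorem pullEuler_congr {g : ℂ → ℂ} (a : ℂ) (h : f =ᶠ[𝓝 x] g) :
    pullEuler φ a f =ᶠ[𝓝 x] pullEuler φ a g := by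
  filter_upwards [h, h.eventuallyEq_nhds] with y hy hnhds
  simp only [pullEuler, pullD, hy, hnhds.deriv_eq]

@[fun_prop]
theorem analyticAt_pullEuler (a : ℂ) (hφ : AnalyticAt ℂ φ x) (hφ' : deriv φ x ≠ 0)
    (hf : AnalyticAt ℂ f x) : AnalyticAt ℂ (pullEuler φ a f) x := by
  unfold pullEuler pullD
  fun_prop (disch := assumption)

theorem pullEuler_mul_of_logDeriv {g : ℂ → ℂ} (a : ℂ) (hf : AnalyticAt ℂ f x)
    (hμ : AnalyticAt ℂ μ x) (hl : pullEuler φ 0 f =ᶠ[𝓝 x] fun y => g y * f y) :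
    pullEuler φ a (fun t => f t * μ t) =ᶠ[𝓝 x]
      fun y => f y * (g y * μ y + pullEuler φ a μ y) := by
  filter_upwards [hl, hf.eventually_analyticAt, hμ.eventually_analyticAt] with y hly hfy hμy
  rw [pullEuler_mul a hfy.differentiableAt hμy.differentiableAt, hly]
  ring

theorem pullEuler_pullEuler_of_logDeriv {l : ℂ → ℂ} (a b : ℂ) (hf : AnalyticAt ℂ f x)
    (hl : AnalyticAt ℂ l x)
    (hlf : pullEuler φ 0 f =ᶠ[𝓝 x] fun y => l y * f y) :
    pullEuler φ a (pullEuler φ b f) =ᶠ[𝓝 x]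
      fun y => f y * (pullEuler φ 0 l y + (l y + a) * (l y + b)) := by
  have hb : pullEuler φ b f =ᶠ[𝓝 x] fun y => f y * (l y + b) := by
    filter_upwards [hlf] with y hy
    simp only [pullEuler] at hy ⊢
    linear_combination hy
  refine (pullEuler_congr a hb).trans ?_
  filter_upwards [pullEuler_mul_of_logDeriv (μ := fun y => l y + b) a hf (by fun_prop) hlf]
    with y hy
  rw [hy]
  simp only [pullEuler, pullD, deriv_add_const]
  ring

theorem pullEuler_add_mul_add {l₁ l : ℂ → ℂ} (a b c : ℂ) (hl : AnalyticAt ℂ l x)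
    (hl₁ : AnalyticAt ℂ l₁ x) :
    pullEuler φ c (fun y => l₁ y + (l y + a) * (l y + b)) x =
      pullEuler φ 0 l₁ x + pullEuler φ 0 l x * (2 * l x + a + b) +
        c * (l₁ x + (l x + a) * (l x + b)) := by
  have hderiv : deriv (fun y => l₁ y + (l y + a) * (l y + b)) x =
      deriv l₁ x + deriv l x * (2 * l x + a + b) := by
    rw [deriv_fun_add (by fun_prop) (by fun_prop), deriv_fun_mul (by fun_prop) (by fun_prop),
      deriv_add_const, deriv_add_const]
    ring
  simp only [pullEuler, pullD, hderiv]
  ring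

theorem pulledBackHypEqAt_of_hypRiccati {θ Y l : ℂ → ℂ} (hφ : AnalyticAt ℂ φ x)
    (hφ0 : φ x ≠ 0) (hφ' : deriv φ x ≠ 0) (hf : AnalyticAt ℂ (fun t => Y t / θ t) x)
    (hl : AnalyticAt ℂ l x)
    (hlf : pullEuler φ 0 (fun t => Y t / θ t) =ᶠ[𝓝 x] fun y => l y * (Y y / θ y))
    (h : HypRiccati a₁ a₂ a₃ b₁ b₂ (φ x) (l x) (pullEuler φ 0 l x)
      (pullEuler φ 0 (pullEuler φ 0 l) x)) :
    PulledBackHypEqAt a₁ a₂ a₃ b₁ b₂ φ θ Y x := by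
  have hδl := analyticAt_pullEuler 0 hφ hφ' hl
  have hthird (a b c : ℂ) :
      pullEuler φ c (pullEuler φ b (pullEuler φ a (fun t => Y t / θ t))) x =
        Y x / θ x * (pullEuler φ 0 (pullEuler φ 0 l) x +
          pullEuler φ 0 l x * (3 * l x + a + b + c) + (l x + a) * (l x + b) * (l x + c)) := by
    rw [(pullEuler_congr c (pullEuler_pullEuler_of_logDeriv b a hf hl hlf)).eq_of_nhds,
      (pullEuler_mul_of_logDeriv c hf (by fun_prop) hlf).eq_of_nhds,
      pullEuler_add_mul_add b a c hl hδl]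
    ring
  rw [PulledBackHypEqAt, pullD_eq_pullEuler_zero_div hφ0, hthird, hthird, eq_div_iff hφ0]
  unfold HypRiccati at h
  linear_combination (Y x / θ x) * h

end RiccatiForm

section LogarithmicDerivatives

/-- The quotient `Y'' / Y` of a function `Y` whose logarithmic derivative is `m`. -/
noncomputable def derivQuot₂ (m : ℂ → ℂ) (x : ℂ) : ℂ := deriv m x + m x ^ 2

/-- The quotient `Y''' / Y` of a function `Y` whose logarithmic derivative is `m`. -/
noncomputable def derivQuot₃ (m : ℂ → ℂ) (x : ℂ) : ℂ :=
  deriv (deriv m) x + 3 * m x * deriv m x + m x ^ 3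

variable {m n F : ℂ → ℂ} {x : ℂ}

theorem derivQuot₂_congr (h : m =ᶠ[𝓝 x] n) : derivQuot₂ m x = derivQuot₂ n x := by
  simp only [derivQuot₂, h.eq_of_nhds, h.deriv_eq]

theorem derivQuot₃_congr (h : m =ᶠ[𝓝 x] n) : derivQuot₃ m x = derivQuot₃ n x := by
  simp only [derivQuot₃, h.eq_of_nhds, h.deriv_eq, h.deriv.deriv_eq]

theorem eventuallyEq_deriv_fun_add (hm : AnalyticAt ℂ m x) (hn : AnalyticAt ℂ n x) :
    deriv (fun y => m y + n y) =ᶠ[𝓝 x] fun y => deriv m y + deriv n y := by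
  filter_upwards [hm.eventually_analyticAt, hn.eventually_analyticAt] with y hmy hny
  exact deriv_fun_add hmy.differentiableAt hny.differentiableAt

theorem eventuallyEq_deriv_fun_mul (hm : AnalyticAt ℂ m x) (hn : AnalyticAt ℂ n x) :
    deriv (fun y => m y * n y) =ᶠ[𝓝 x] fun y => deriv m y * n y + m y * deriv n y := by
  filter_upwards [hm.eventually_analyticAt, hn.eventually_analyticAt] with y hmy hny
  exact deriv_fun_mul hmy.differentiableAt hny.differentiableAt

theorem deriv_deriv_fun_add (hm : AnalyticAt ℂ m x) (hn : AnalyticAt ℂ n x) :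
    deriv (deriv fun y => m y + n y) x = deriv (deriv m) x + deriv (deriv n) x := by
  rw [(eventuallyEq_deriv_fun_add hm hn).deriv_eq, deriv_fun_add (by fun_prop) (by fun_prop)]

theorem deriv_deriv_fun_mul (hm : AnalyticAt ℂ m x) (hn : AnalyticAt ℂ n x) :
    deriv (deriv fun y => m y * n y) x =
      deriv (deriv m) x * n x + 2 * (deriv m x * deriv n x) + m x * deriv (deriv n) x := by
  rw [(eventuallyEq_deriv_fun_mul hm hn).deriv_eq, deriv_fun_add (by fun_prop) (by fun_prop),
    deriv_fun_mul (by fun_prop) (by fun_prop), deriv_fun_mul (by fun_prop) (by fun_prop)]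
  ring

theorem derivQuot₂_add (hm : DifferentiableAt ℂ m x) (hn : DifferentiableAt ℂ n x) :
    derivQuot₂ (fun y => m y + n y) x = derivQuot₂ m x + 2 * m x * n x + derivQuot₂ n x := by
  simp only [derivQuot₂, deriv_fun_add hm hn]
  ring

theorem derivQuot₃_add (hm : AnalyticAt ℂ m x) (hn : AnalyticAt ℂ n x) :
    derivQuot₃ (fun y => m y + n y) x =
      derivQuot₃ m x + 3 * derivQuot₂ m x * n x + 3 * m x * derivQuot₂ n x + derivQuot₃ n x := by
  simp only [derivQuot₃, derivQuot₂, deriv_deriv_fun_add hm hn,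
    deriv_fun_add hm.differentiableAt hn.differentiableAt]
  ring

@[fun_prop]
theorem analyticAt_logDeriv (hF : AnalyticAt ℂ F x) (hF0 : F x ≠ 0) :
    AnalyticAt ℂ (logDeriv F) x := hF.deriv.div hF hF0

theorem eventuallyEq_deriv_logDeriv (hF : AnalyticAt ℂ F x) (hF0 : F x ≠ 0) :
    deriv (logDeriv F) =ᶠ[𝓝 x] fun y => deriv (deriv F) y / F y - (logDeriv F y) ^ 2 := by
  filter_upwards [hF.eventually_analyticAt, hF.continuousAt.eventually_ne hF0] with y hy hy0
  rw [logDeriv, deriv_div (by fun_prop) (by fun_prop) hy0, Pi.div_apply]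
  field_simp

theorem deriv_deriv_logDeriv (hF : AnalyticAt ℂ F x) (hF0 : F x ≠ 0) :
    deriv (deriv (logDeriv F)) x = deriv (deriv (deriv F)) x / F x -
      3 * logDeriv F x * (deriv (deriv F) x / F x) + 2 * logDeriv F x ^ 3 := by
  have hsq : DifferentiableAt ℂ (fun y => logDeriv F y ^ 2) x := by fun_prop (disch := assumption)
  rw [(eventuallyEq_deriv_logDeriv hF hF0).deriv_eq,
    deriv_fun_sub (by fun_prop (disch := assumption)) hsq,
    deriv_fun_div (by fun_prop) (by fun_prop) hF0,
    deriv_fun_pow (by fun_prop (disch := assumption)),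
    (eventuallyEq_deriv_logDeriv hF hF0).eq_of_nhds]
  simp only [logDeriv_apply, Nat.reduceSub, pow_one]
  field_simp
  ring

theorem derivQuot₂_logDeriv (hF : AnalyticAt ℂ F x) (hF0 : F x ≠ 0) :
    derivQuot₂ (logDeriv F) x = deriv (deriv F) x / F x := by
  rw [derivQuot₂, (eventuallyEq_deriv_logDeriv hF hF0).eq_of_nhds]
  ring

theorem derivQuot₂_logDeriv_div_four (hF : AnalyticAt ℂ F x) (hF0 : F x ≠ 0) :
    derivQuot₂ (fun y => logDeriv F y / 4) x =
      deriv (deriv F) x / (4 * F x) - 3 / 16 * logDeriv F x ^ 2 := by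
  rw [derivQuot₂, deriv_div_const, (eventuallyEq_deriv_logDeriv hF hF0).eq_of_nhds]
  ring

theorem derivQuot₃_logDeriv_div_four (hF : AnalyticAt ℂ F x) (hF0 : F x ≠ 0) :
    derivQuot₃ (fun y => logDeriv F y / 4) x = deriv (deriv (deriv F)) x / (4 * F x) -
      9 / 16 * logDeriv F x * (deriv (deriv F) x / F x) + 21 / 64 * logDeriv F x ^ 3 := by
  have hderiv : deriv (fun y => logDeriv F y / 4) = fun y => deriv (logDeriv F) y / 4 :=
    funext fun y => deriv_div_const 4
  simp only [derivQuot₃, hderiv, deriv_div_const, deriv_deriv_logDeriv hF hF0,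
    (eventuallyEq_deriv_logDeriv hF hF0).eq_of_nhds]
  ring

variable {φ l : ℂ → ℂ}

theorem deriv_eq_logDeriv_mul_pullEuler (hφ0 : φ x ≠ 0) (hφ' : deriv φ x ≠ 0) :
    deriv l x = logDeriv φ x * pullEuler φ 0 l x := by
  rw [logDeriv_apply, pullEuler, pullD]
  field_simp
  ring

theorem deriv_deriv_eq_logDeriv_mul_pullEuler (hφ : AnalyticAt ℂ φ x) (hφ0 : φ x ≠ 0)
    (hφ' : deriv φ x ≠ 0) (hl : AnalyticAt ℂ l x) :
    deriv (deriv l) x = deriv (logDeriv φ) x * pullEuler φ 0 l x +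
      logDeriv φ x ^ 2 * pullEuler φ 0 (pullEuler φ 0 l) x := by
  have hδl := analyticAt_pullEuler 0 hφ hφ' hl
  have hderiv : deriv l =ᶠ[𝓝 x] fun y => logDeriv φ y * pullEuler φ 0 l y := by
    filter_upwards [hφ.continuousAt.eventually_ne hφ0, hφ.deriv.continuousAt.eventually_ne hφ']
      with y using deriv_eq_logDeriv_mul_pullEuler
  rw [hderiv.deriv_eq,
    deriv_fun_mul (analyticAt_logDeriv hφ hφ0).differentiableAt hδl.differentiableAt,
    deriv_eq_logDeriv_mul_pullEuler (l := pullEuler φ 0 l) hφ0 hφ']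
  ring

theorem derivQuot₂_logDeriv_mul (hφ : AnalyticAt ℂ φ x) (hφ0 : φ x ≠ 0) (hφ' : deriv φ x ≠ 0)
    (hl : AnalyticAt ℂ l x) :
    derivQuot₂ (fun y => logDeriv φ y * l y) x =
      deriv (logDeriv φ) x * l x + logDeriv φ x ^ 2 * (pullEuler φ 0 l x + l x ^ 2) := by
  rw [derivQuot₂, deriv_fun_mul (by fun_prop (disch := assumption)) (by fun_prop),
    deriv_eq_logDeriv_mul_pullEuler (l := l) hφ0 hφ']
  ring

theorem derivQuot₃_logDeriv_mul (hφ : AnalyticAt ℂ φ x) (hφ0 : φ x ≠ 0) (hφ' : deriv φ x ≠ 0)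
    (hl : AnalyticAt ℂ l x) :
    derivQuot₃ (fun y => logDeriv φ y * l y) x =
      deriv (deriv (logDeriv φ)) x * l x +
        3 * logDeriv φ x * deriv (logDeriv φ) x * (pullEuler φ 0 l x + l x ^ 2) +
        logDeriv φ x ^ 3 * (pullEuler φ 0 (pullEuler φ 0 l) x +
          3 * l x * pullEuler φ 0 l x + l x ^ 3) := by
  have hw := analyticAt_logDeriv hφ hφ0
  rw [derivQuot₃, deriv_deriv_fun_mul hw hl,
    deriv_fun_mul hw.differentiableAt hl.differentiableAt,
    deriv_deriv_eq_logDeriv_mul_pullEuler hφ hφ0 hφ' hl,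
    deriv_eq_logDeriv_mul_pullEuler (l := l) hφ0 hφ']
  ring

end LogarithmicDerivatives

section Polynomials

@[fun_prop] theorem analyticAt_P₄ (x : ℂ) : AnalyticAt ℂ P₄ x := by unfold P₄; fun_prop

@[fun_prop] theorem analyticAt_Q₄ (x : ℂ) : AnalyticAt ℂ Q₄ x := by unfold Q₄; fun_prop

@[fun_prop] theorem analyticAt_Q₈ (x : ℂ) : AnalyticAt ℂ Q₈ x := by unfold Q₈; fun_prop

@[fun_prop] theorem analyticAt_R₁ (x : ℂ) : AnalyticAt ℂ R₁ x := by unfold R₁; fun_prop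

@[fun_prop] theorem analyticAt_R₂ (x : ℂ) : AnalyticAt ℂ R₂ x := by unfold R₂; fun_prop

theorem deriv_P₄ (x : ℂ) : deriv P₄ x = -1 + 1 / 2 * x - 3 / 56 * x ^ 2 := by
  unfold P₄
  simp (disch := fun_prop) only [deriv_fun_add, deriv_fun_sub, deriv_fun_mul, deriv_fun_pow,
    deriv_const_sub_id', deriv_const', deriv_id'', Nat.cast_ofNat, Nat.add_one_sub_one]
  ring

theorem deriv_deriv_P₄ (x : ℂ) : deriv (deriv P₄) x = 1 / 2 - 3 / 28 * x := by
  rw [funext deriv_P₄]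
  simp (disch := fun_prop) only [deriv_fun_add, deriv_fun_sub, deriv_fun_mul, deriv_fun_pow,
    deriv_const_mul_id', deriv_const', deriv_id'', Nat.cast_ofNat, Nat.add_one_sub_one]
  ring

theorem deriv_deriv_deriv_P₄ (x : ℂ) : deriv (deriv (deriv P₄)) x = -3 / 28 := by
  rw [funext deriv_deriv_P₄]
  simp (disch := fun_prop) only [deriv_fun_sub, deriv_const_mul_id', deriv_const']
  ring

theorem deriv_Q₄ (x : ℂ) : deriv Q₄ x =
    -1 / 2 + 1 / 14 * x + 3 / 56 * x ^ 2 - 1 / 98 * x ^ 3 := by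
  unfold Q₄
  simp (disch := fun_prop) only [deriv_fun_add, deriv_fun_sub, deriv_fun_mul, deriv_fun_pow,
    deriv_const_mul_id', deriv_const', deriv_id'', Nat.cast_ofNat, Nat.add_one_sub_one]
  ring

theorem deriv_deriv_Q₄ (x : ℂ) : deriv (deriv Q₄) x = 1 / 14 + 3 / 28 * x - 3 / 98 * x ^ 2 := by
  rw [funext deriv_Q₄]
  simp (disch := fun_prop) only [deriv_fun_add, deriv_fun_sub, deriv_fun_mul, deriv_fun_pow,
    deriv_const_mul_id', deriv_const', deriv_id'', Nat.cast_ofNat, Nat.add_one_sub_one]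
  ring

theorem deriv_Q₈ (x : ℂ) : deriv Q₈ x =
    (3 - 9 / 2 * x + 3 / 2 * x ^ 2 - 1 / 7 * x ^ 3) *
        (1 - 5 / 8 * x + 3 / 16 * x ^ 2 - 1 / 32 * x ^ 3 + 1 / 448 * x ^ 4) +
      (1 + 3 * x - 9 / 4 * x ^ 2 + 1 / 2 * x ^ 3 - 1 / 28 * x ^ 4) *
        (-5 / 8 + 3 / 8 * x - 3 / 32 * x ^ 2 + 1 / 112 * x ^ 3) := by
  unfold Q₈
  simp (disch := fun_prop) only [deriv_fun_add, deriv_fun_sub, deriv_fun_mul, deriv_fun_pow,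
    deriv_const_mul_id', deriv_const', deriv_id'', Nat.cast_ofNat, Nat.add_one_sub_one]
  ring

theorem deriv_deriv_Q₈ (x : ℂ) : deriv (deriv Q₈) x =
    (-9 / 2 + 3 * x - 3 / 7 * x ^ 2) *
        (1 - 5 / 8 * x + 3 / 16 * x ^ 2 - 1 / 32 * x ^ 3 + 1 / 448 * x ^ 4) +
      2 * (3 - 9 / 2 * x + 3 / 2 * x ^ 2 - 1 / 7 * x ^ 3) *
        (-5 / 8 + 3 / 8 * x - 3 / 32 * x ^ 2 + 1 / 112 * x ^ 3) +
      (1 + 3 * x - 9 / 4 * x ^ 2 + 1 / 2 * x ^ 3 - 1 / 28 * x ^ 4) *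
        (3 / 8 - 3 / 16 * x + 3 / 112 * x ^ 2) := by
  rw [funext deriv_Q₈]
  simp (disch := fun_prop) only [deriv_fun_add, deriv_fun_sub, deriv_fun_mul, deriv_fun_pow,
    deriv_const_mul_id', deriv_const', deriv_id'', Nat.cast_ofNat, Nat.add_one_sub_one]
  ring

theorem deriv_R₁ (x : ℂ) : deriv R₁ x = -3 / 8 + 1 / 14 * x := by
  unfold R₁
  simp (disch := fun_prop) only [deriv_fun_add, deriv_fun_sub, deriv_fun_mul, deriv_fun_pow,
    deriv_const_mul_id', deriv_const', deriv_id'', Nat.cast_ofNat, Nat.add_one_sub_one]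
  ring

theorem deriv_deriv_R₁ (x : ℂ) : deriv (deriv R₁) x = 1 / 14 := by
  rw [funext deriv_R₁]
  simp (disch := fun_prop) only [deriv_fun_add, deriv_const_mul_id', deriv_const']
  ring

theorem deriv_R₂ (x : ℂ) : deriv R₂ x =
    -33 / 32 + 13 / 16 * x - 27 / 128 * x ^ 2 + 1 / 56 * x ^ 3 := by
  unfold R₂
  simp (disch := fun_prop) only [deriv_fun_add, deriv_fun_sub, deriv_fun_mul, deriv_fun_pow,
    deriv_const_mul_id', deriv_const', deriv_id'', Nat.cast_ofNat, Nat.add_one_sub_one]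
  ring

theorem deriv_deriv_R₂ (x : ℂ) : deriv (deriv R₂) x = 13 / 16 - 27 / 64 * x + 3 / 56 * x ^ 2 := by
  rw [funext deriv_R₂]
  simp (disch := fun_prop) only [deriv_fun_add, deriv_fun_sub, deriv_fun_mul, deriv_fun_pow,
    deriv_const_mul_id', deriv_const', deriv_id'', Nat.cast_ofNat, Nat.add_one_sub_one]
  ring

end Polynomials

section Covering

variable {x : ℂ}

/-- The points of the `x`-plane, other than poles of `Ψ₄`, that do not lie over the singular
values `0` and `1` of the hypergeometric equation. -/
structure RegularPoint (x : ℂ) : Prop where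
  ne_zero : x ≠ 0
  P₄_ne : P₄ x ≠ 0
  Q₄_ne : Q₄ x ≠ 0
  Q₈_ne : Q₈ x ≠ 0
  R₁_ne : R₁ x ≠ 0
  R₂_ne : R₂ x ≠ 0

theorem eventually_regularPoint : ∀ᶠ x in 𝓝[≠] (0 : ℂ), RegularPoint x := by
  have hne {F : ℂ → ℂ} (hF : AnalyticAt ℂ F 0) (hF0 : F 0 = 1) : ∀ᶠ x in 𝓝[≠] 0, F x ≠ 0 :=
    (hF.continuousAt.eventually_ne (by simp [hF0])).filter_mono nhdsWithin_le_nhds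
  filter_upwards [self_mem_nhdsWithin, hne (analyticAt_P₄ 0) (by simp [P₄]),
    hne (analyticAt_Q₄ 0) (by simp [Q₄]), hne (analyticAt_Q₈ 0) (by simp [Q₈]),
    hne (analyticAt_R₁ 0) (by simp [R₁]), hne (analyticAt_R₂ 0) (by simp [R₂])]
    with x h0 hP hQ₄ hQ₈ hR₁ hR₂
  exact ⟨h0, hP, hQ₄, hQ₈, hR₁, hR₂⟩

theorem Ψ₄_eq (hP : P₄ x ≠ 0) :
    Ψ₄ x = -(343 * x * R₁ x ^ 2 * Q₄ x ^ 4) / (32 * P₄ x ^ 7) := by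
  have hden : x ^ 3 - 14 * x ^ 2 + 56 * x - 56 = -56 * P₄ x := by
    simp only [P₄]
    ring
  have hnum : x * (2 * x ^ 2 - 21 * x + 56) ^ 2 * (x ^ 2 - 28) ^ 4 * (x ^ 2 - 7 * x + 14) ^ 4 =
      x * (56 * R₁ x) ^ 2 * (392 * Q₄ x) ^ 4 := by
    simp only [R₁, Q₄]
    ring
  rw [Ψ₄, hden, hnum, div_eq_div_iff (by simpa using hP) (by simpa using hP)]
  ring

theorem R₂_mul_Q₈_sq (x : ℂ) :
    R₂ x * Q₈ x ^ 2 = P₄ x ^ 7 + 343 / 32 * x * R₁ x ^ 2 * Q₄ x ^ 4 := by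
  simp only [P₄, R₁, Q₄, R₂, Q₈]
  ring

theorem one_sub_Ψ₄ (hP : P₄ x ≠ 0) : 1 - Ψ₄ x = R₂ x * Q₈ x ^ 2 / P₄ x ^ 7 := by
  rw [Ψ₄_eq hP, R₂_mul_Q₈_sq]
  field_simp
  ring

@[fun_prop]
theorem analyticAt_Ψ₄ (hP : P₄ x ≠ 0) : AnalyticAt ℂ Ψ₄ x := by
  have hden : 4 * (x ^ 3 - 14 * x ^ 2 + 56 * x - 56) ^ 7 ≠ 0 := by
    rw [show x ^ 3 - 14 * x ^ 2 + 56 * x - 56 = -56 * P₄ x by simp only [P₄]; ring]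
    simpa using hP
  unfold Ψ₄
  fun_prop (disch := assumption)

theorem deriv_Ψ₄_numerator_eq_Q₈ (x : ℂ) :
    R₁ x * Q₄ x * P₄ x + 2 * x * deriv R₁ x * Q₄ x * P₄ x + 4 * x * R₁ x * deriv Q₄ x * P₄ x -
      7 * x * R₁ x * Q₄ x * deriv P₄ x = Q₈ x := by
  simp only [deriv_R₁, deriv_Q₄, deriv_P₄, R₁, Q₄, P₄, Q₈]
  ring

theorem deriv_Ψ₄ (hP : P₄ x ≠ 0) :
    deriv Ψ₄ x = -343 / 32 * (R₁ x * Q₄ x ^ 3 * Q₈ x / P₄ x ^ 8) := by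
  have hΨ : Ψ₄ =ᶠ[𝓝 x] fun y => -343 / 32 * (y * R₁ y ^ 2 * Q₄ y ^ 4 / P₄ y ^ 7) := by
    filter_upwards [(analyticAt_P₄ x).continuousAt.eventually_ne hP] with y hy
    rw [Ψ₄_eq hy]
    ring
  have hpow : DifferentiableAt ℂ (fun y => P₄ y ^ 7) x := by fun_prop
  rw [hΨ.deriv_eq, deriv_const_mul_field, ← deriv_Ψ₄_numerator_eq_Q₈,
    deriv_fun_div (by fun_prop) hpow (pow_ne_zero 7 hP), deriv_fun_mul (by fun_prop) (by fun_prop),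
    deriv_fun_mul (by fun_prop) (by fun_prop), deriv_fun_pow (by fun_prop),
    deriv_fun_pow (by fun_prop), deriv_fun_pow (by fun_prop), deriv_id'']
  field_simp
  ring

theorem RegularPoint.Ψ₄_ne (h : RegularPoint x) : Ψ₄ x ≠ 0 := by
  obtain ⟨h0, hP, hQ₄, -, hR₁, -⟩ := h
  simp [Ψ₄_eq hP, h0, hP, hQ₄, hR₁]

theorem RegularPoint.Ψ₄_ne_one (h : RegularPoint x) : Ψ₄ x ≠ 1 := by
  obtain ⟨-, hP, -, hQ₈, -, hR₂⟩ := h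
  have hne : 1 - Ψ₄ x ≠ 0 := by simp [one_sub_Ψ₄ hP, hP, hQ₈, hR₂]
  exact (sub_ne_zero.1 hne).symm

theorem RegularPoint.deriv_Ψ₄_ne (h : RegularPoint x) : deriv Ψ₄ x ≠ 0 := by
  obtain ⟨-, hP, hQ₄, hQ₈, hR₁, -⟩ := h
  simp [deriv_Ψ₄ hP, hP, hQ₄, hQ₈, hR₁]

theorem RegularPoint.eventually (h : RegularPoint x) : ∀ᶠ y in 𝓝 x, RegularPoint y := by
  obtain ⟨h0, hP, hQ₄, hQ₈, hR₁, hR₂⟩ := h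
  filter_upwards [eventually_ne_nhds h0, (analyticAt_P₄ x).continuousAt.eventually_ne hP,
    (analyticAt_Q₄ x).continuousAt.eventually_ne hQ₄,
    (analyticAt_Q₈ x).continuousAt.eventually_ne hQ₈,
    (analyticAt_R₁ x).continuousAt.eventually_ne hR₁,
    (analyticAt_R₂ x).continuousAt.eventually_ne hR₂] with y h0 hP hQ₄ hQ₈ hR₁ hR₂
  exact ⟨h0, hP, hQ₄, hQ₈, hR₁, hR₂⟩

theorem RegularPoint.logDeriv_Ψ₄ (h : RegularPoint x) :
    logDeriv Ψ₄ x = Q₈ x / (x * R₁ x * Q₄ x * P₄ x) := by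
  obtain ⟨h0, hP, hQ₄, hQ₈, hR₁, -⟩ := h
  rw [logDeriv_apply, deriv_Ψ₄ hP, Ψ₄_eq hP]
  field_simp

theorem RegularPoint.logDeriv_Ψ₄_eq_sum (h : RegularPoint x) :
    logDeriv Ψ₄ x =
      1 / x + 2 * logDeriv R₁ x + 4 * logDeriv Q₄ x - 7 * logDeriv P₄ x := by
  rw [h.logDeriv_Ψ₄, ← deriv_Ψ₄_numerator_eq_Q₈]
  obtain ⟨h0, hP, hQ₄, -, hR₁, -⟩ := h
  simp only [logDeriv_apply]
  field_simp

theorem RegularPoint.logDeriv_one_sub_Ψ₄ (h : RegularPoint x) :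
    logDeriv (fun y => 1 - Ψ₄ y) x =
      logDeriv R₂ x + 2 * logDeriv Q₈ x - 7 * logDeriv P₄ x := by
  have hfactor : (fun y => 1 - Ψ₄ y) =ᶠ[𝓝 x] fun y => R₂ y * Q₈ y ^ 2 / P₄ y ^ 7 := by
    filter_upwards [h.eventually] with y hy using one_sub_Ψ₄ hy.P₄_ne
  obtain ⟨-, hP, -, hQ₈, -, hR₂⟩ := h
  rw [(logDeriv_congr_nhds hfactor).eq_of_nhds,
    logDeriv_div x (by simp [*]) (by simp [*]) (by fun_prop) (by fun_prop),
    logDeriv_mul x hR₂ (by simp [*]) (by fun_prop) (by fun_prop),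
    logDeriv_fun_pow (by fun_prop), logDeriv_fun_pow (by fun_prop)]
  norm_num

end Covering

section PulledBackEquation

variable {x : ℂ}

/-- The logarithmic derivative of the gauge factor `P₄ ^ (1 / 4)`. -/
noncomputable def gauge (x : ℂ) : ℂ := logDeriv P₄ x / 4

/-- The coefficient of `Y''` in the pulled-back equation, made monic. -/
noncomputable def odeCoeff₂ (x : ℂ) : ℂ :=
  9 / (4 * x) + 3 / 2 * (logDeriv R₁ x + logDeriv R₂ x) - 3 * logDeriv P₄ x

/-- The coefficient of `Y'` in the pulled-back equation, made monic. -/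
noncomputable def odeCoeff₁ (x : ℂ) : ℂ :=
  (3 / 8 - 255 / 512 * x + 1101 / 4096 * x ^ 2 - 39 / 448 * x ^ 3 + 225 / 8192 * x ^ 4 -
    14955 / 1605632 * x ^ 5 + 7251 / 3211264 * x ^ 6 - 2007 / 6422528 * x ^ 7 +
    69 / 3211264 * x ^ 8 - 3 / 5619712 * x ^ 9) / (x ^ 2 * R₁ x * R₂ x * P₄ x)

/-- The coefficient of `Y` in the pulled-back equation, made monic. -/
noncomputable def odeCoeff₀ (x : ℂ) : ℂ :=
  (135 / 2048 - 735 / 16384 * x - 405 / 57344 * x ^ 2 + 3585 / 229376 * x ^ 3 -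
    40335 / 6422528 * x ^ 4 + 15807 / 12845056 * x ^ 5 - 3315 / 25690112 * x ^ 6 +
    87 / 12845056 * x ^ 7 - 3 / 22478848 * x ^ 8) / (x ^ 2 * R₁ x * R₂ x * P₄ x)

/-- The pulled-back equation at `x`, for a function whose logarithmic derivative is `m`. -/
def RiccatiAt (m : ℂ → ℂ) (x : ℂ) : Prop :=
  derivQuot₃ m x + odeCoeff₂ x * derivQuot₂ m x + odeCoeff₁ x * m x + odeCoeff₀ x = 0

theorem RiccatiAt.congr {m n : ℂ → ℂ} (hm : RiccatiAt m x) (h : m =ᶠ[𝓝 x] n) :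
    RiccatiAt n x := by
  rwa [RiccatiAt, ← derivQuot₂_congr h, ← derivQuot₃_congr h, ← h.eq_of_nhds]

theorem RegularPoint.logDeriv_logDeriv_Ψ₄ (h : RegularPoint x) :
    logDeriv (logDeriv Ψ₄) x =
      logDeriv Q₈ x - (1 / x + logDeriv R₁ x + logDeriv Q₄ x + logDeriv P₄ x) := by
  have hquot : logDeriv Ψ₄ =ᶠ[𝓝 x] fun y => Q₈ y / (y * R₁ y * Q₄ y * P₄ y) := by
    filter_upwards [h.eventually] with y hy using hy.logDeriv_Ψ₄
  obtain ⟨h0, hP, hQ₄, hQ₈, hR₁, -⟩ := h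
  rw [(logDeriv_congr_nhds hquot).eq_of_nhds,
    logDeriv_div x hQ₈ (by simp [*]) (by fun_prop) (by fun_prop),
    logDeriv_mul x (by simp [*]) hP (by fun_prop) (by fun_prop),
    logDeriv_mul x (by simp [*]) hQ₄ (by fun_prop) (by fun_prop),
    logDeriv_mul x h0 hR₁ (by fun_prop) (by fun_prop), logDeriv_id']

theorem RegularPoint.deriv_logDeriv_logDeriv_Ψ₄ (h : RegularPoint x) :
    deriv (logDeriv (logDeriv Ψ₄)) x =
      deriv (logDeriv Q₈) x -
        (-1 / x ^ 2 + deriv (logDeriv R₁) x + deriv (logDeriv Q₄) x + deriv (logDeriv P₄) x) := by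
  have hsum : logDeriv (logDeriv Ψ₄) =ᶠ[𝓝 x] fun y =>
      logDeriv Q₈ y - (1 / y + logDeriv R₁ y + logDeriv Q₄ y + logDeriv P₄ y) := by
    filter_upwards [h.eventually] with y hy using hy.logDeriv_logDeriv_Ψ₄
  obtain ⟨h0, hP, hQ₄, hQ₈, hR₁, -⟩ := h
  have hinv : deriv (fun y : ℂ => 1 / y) x = -1 / x ^ 2 := by simp [div_eq_mul_inv]
  rw [hsum.deriv_eq, deriv_fun_sub, deriv_fun_add, deriv_fun_add, deriv_fun_add, hinv]
  all_goals fun_prop (disch := assumption)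

theorem RegularPoint.logDeriv_Ψ₄_ne (h : RegularPoint x) : logDeriv Ψ₄ x ≠ 0 :=
  div_ne_zero h.deriv_Ψ₄_ne h.Ψ₄_ne

theorem RegularPoint.analyticAt_Ψ₄ (h : RegularPoint x) : AnalyticAt ℂ Ψ₄ x :=
  Darboux.analyticAt_Ψ₄ h.P₄_ne

theorem RegularPoint.analyticAt_logDeriv_Ψ₄ (h : RegularPoint x) :
    AnalyticAt ℂ (logDeriv Ψ₄) x :=
  analyticAt_logDeriv h.analyticAt_Ψ₄ h.Ψ₄_ne

theorem RegularPoint.analyticAt_gauge (h : RegularPoint x) : AnalyticAt ℂ gauge x :=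
  (analyticAt_logDeriv (by fun_prop) h.P₄_ne).div_const

theorem RegularPoint.odeCoeff₂_match (h : RegularPoint x) :
    (3 * deriv (logDeriv Ψ₄) x + (odeCoeff₂ x + 3 * gauge x) * logDeriv Ψ₄ x) * (1 - Ψ₄ x) =
      -3 / 4 * (1 + Ψ₄ x) * logDeriv Ψ₄ x ^ 2 := by
  have hw := h.logDeriv_Ψ₄_ne
  have hΨ := h.Ψ₄_ne
  have hΨ1 : 1 - Ψ₄ x ≠ 0 := sub_ne_zero.2 h.Ψ₄_ne_one.symm
  have hww := h.logDeriv_logDeriv_Ψ₄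
  have hsum := h.logDeriv_Ψ₄_eq_sum
  have hone := h.logDeriv_one_sub_Ψ₄
  have hderiv : deriv Ψ₄ x = logDeriv Ψ₄ x * Ψ₄ x := by rw [logDeriv_apply]; field_simp
  rw [logDeriv_apply, div_eq_iff hw] at hww
  rw [logDeriv_apply, deriv_const_sub, div_eq_iff hΨ1, hderiv] at hone
  rw [hww, odeCoeff₂, gauge]
  linear_combination (3 / 4 * (1 - Ψ₄ x) * logDeriv Ψ₄ x) * hsum - 3 / 2 * logDeriv Ψ₄ x * hone

theorem RegularPoint.odeCoeff₁_match_mul (h : RegularPoint x) :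
    (derivQuot₂ (logDeriv (logDeriv Ψ₄)) x +
        (odeCoeff₂ x + 3 * gauge x) * logDeriv (logDeriv Ψ₄) x +
        (odeCoeff₁ x + 2 * odeCoeff₂ x * gauge x + 3 * derivQuot₂ gauge x)) *
      (R₂ x * Q₈ x ^ 2) =
      (1 / 8 * P₄ x ^ 7 + 5 / 112 * (343 / 32 * x * R₁ x ^ 2 * Q₄ x ^ 4)) *
        logDeriv Ψ₄ x ^ 2 := by
  rw [derivQuot₂, h.deriv_logDeriv_logDeriv_Ψ₄, h.logDeriv_logDeriv_Ψ₄, h.logDeriv_Ψ₄]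
  obtain ⟨h0, hP, hQ₄, hQ₈, hR₁, hR₂⟩ := h
  have hdd {F : ℂ → ℂ} (hF : AnalyticAt ℂ F x) (hF0 : F x ≠ 0) :=
    (eventuallyEq_deriv_logDeriv hF hF0).eq_of_nhds
  unfold gauge
  rw [derivQuot₂_logDeriv_div_four (by fun_prop) hP, hdd (by fun_prop) hP, hdd (by fun_prop) hQ₄,
    hdd (by fun_prop) hQ₈, hdd (by fun_prop) hR₁]
  simp only [odeCoeff₁, odeCoeff₂, logDeriv_apply]
  field_simp
  simp only [deriv_P₄, deriv_deriv_P₄, deriv_Q₄, deriv_deriv_Q₄, deriv_Q₈, deriv_deriv_Q₈, deriv_R₁,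
    deriv_deriv_R₁, deriv_R₂, P₄, Q₄, Q₈, R₁, R₂]
  ring

theorem RegularPoint.odeCoeff₁_match (h : RegularPoint x) :
    (deriv (deriv (logDeriv Ψ₄)) x + (odeCoeff₂ x + 3 * gauge x) * deriv (logDeriv Ψ₄) x +
        (odeCoeff₁ x + 2 * odeCoeff₂ x * gauge x + 3 * derivQuot₂ gauge x) * logDeriv Ψ₄ x) *
      (1 - Ψ₄ x) = (1 / 8 - 5 / 112 * Ψ₄ x) * logDeriv Ψ₄ x ^ 3 := by
  have hw := h.logDeriv_Ψ₄_ne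
  have hw' : deriv (logDeriv Ψ₄) x = logDeriv (logDeriv Ψ₄) x * logDeriv Ψ₄ x := by
    rw [logDeriv_apply (logDeriv Ψ₄), div_mul_cancel₀ _ hw]
  have hw'' : deriv (deriv (logDeriv Ψ₄)) x =
      derivQuot₂ (logDeriv (logDeriv Ψ₄)) x * logDeriv Ψ₄ x := by
    rw [derivQuot₂_logDeriv h.analyticAt_logDeriv_Ψ₄ hw, div_mul_cancel₀ _ hw]
  have hpoly := h.odeCoeff₁_match_mul
  have hP := h.P₄_ne
  rw [hw', hw'', one_sub_Ψ₄ hP, Ψ₄_eq hP]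
  field_simp
  linear_combination 28672 * hpoly

theorem RegularPoint.odeCoeff₀_match (h : RegularPoint x) :
    (odeCoeff₀ x + odeCoeff₁ x * gauge x + odeCoeff₂ x * derivQuot₂ gauge x +
      derivQuot₃ gauge x) * (1 - Ψ₄ x) = 57 / 21952 * Ψ₄ x * logDeriv Ψ₄ x ^ 3 := by
  have hw := h.logDeriv_Ψ₄
  obtain ⟨h0, hP, hQ₄, hQ₈, hR₁, hR₂⟩ := h
  have hpoly : odeCoeff₀ x + odeCoeff₁ x * gauge x + odeCoeff₂ x * derivQuot₂ gauge x +
      derivQuot₃ gauge x =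
      -57 / 2048 * Q₄ x * Q₈ x / (x ^ 2 * R₁ x * R₂ x * P₄ x ^ 3) := by
    unfold gauge
    rw [derivQuot₂_logDeriv_div_four (by fun_prop) hP,
      derivQuot₃_logDeriv_div_four (by fun_prop) hP]
    simp only [odeCoeff₀, odeCoeff₁, odeCoeff₂, logDeriv_apply]
    field_simp
    simp only [deriv_P₄, deriv_deriv_P₄, deriv_deriv_deriv_P₄, deriv_R₁, deriv_R₂, P₄, Q₄, Q₈, R₁,
      R₂]
    ring
  rw [hpoly, one_sub_Ψ₄ hP, Ψ₄_eq hP, hw]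
  field_simp
  norm_num

theorem RiccatiAt.hypRiccati {m l : ℂ → ℂ} (h : RegularPoint x) (hl : AnalyticAt ℂ l x)
    (hm : RiccatiAt m x) (hml : m =ᶠ[𝓝 x] fun y => gauge y + logDeriv Ψ₄ y * l y) :
    HypRiccati (-1 / 28) (3 / 28) (19 / 28) (1 / 2) (3 / 4) (Ψ₄ x) (l x) (pullEuler Ψ₄ 0 l x)
      (pullEuler Ψ₄ 0 (pullEuler Ψ₄ 0 l) x) := by
  have hΨ := h.analyticAt_Ψ₄
  have hn : AnalyticAt ℂ (fun y => logDeriv Ψ₄ y * l y) x := h.analyticAt_logDeriv_Ψ₄.mul hl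
  have hode := hm.congr hml
  rw [RiccatiAt, derivQuot₃_add h.analyticAt_gauge hn,
    derivQuot₂_add h.analyticAt_gauge.differentiableAt hn.differentiableAt,
    derivQuot₂_logDeriv_mul hΨ h.Ψ₄_ne h.deriv_Ψ₄_ne hl,
    derivQuot₃_logDeriv_mul hΨ h.Ψ₄_ne h.deriv_Ψ₄_ne hl] at hode
  refine mul_left_cancel₀ (pow_ne_zero 3 h.logDeriv_Ψ₄_ne) ?_
  linear_combination
    logDeriv Ψ₄ x * (pullEuler Ψ₄ 0 l x + l x ^ 2) * h.odeCoeff₂_match +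
      l x * h.odeCoeff₁_match + h.odeCoeff₀_match - (1 - Ψ₄ x) * hode

end PulledBackEquation

section QuarticSolutions

variable {x : ℂ}

/-- The fourth root of `F` solves the pulled-back equation near `x`; working with `F` itself
avoids choosing a branch of the root. -/
structure QuarticSolutionAt (F : ℂ → ℂ) (x : ℂ) : Prop where
  analyticAt : AnalyticAt ℂ F x
  ne_zero : F x ≠ 0
  riccatiAt : RiccatiAt (fun y => logDeriv F y / 4) x

variable {F f : ℂ → ℂ} {κ : ℂ} {k : ℕ}

theorem pullEuler_eq_of_pow_four (h : RegularPoint x) (hF : DifferentiableAt ℂ F x)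
    (hF0 : F x ≠ 0) (hf : DifferentiableAt ℂ f x) (hκ : κ ≠ 0)
    (hpow : ∀ᶠ y in 𝓝 x, f y ^ 4 = κ * (F y / (P₄ y * Ψ₄ y ^ k))) :
    pullEuler Ψ₄ 0 f x = ((logDeriv F x / 4 - gauge x) / logDeriv Ψ₄ x - k / 4) * f x := by
  have hP := h.P₄_ne
  have hΨ := h.Ψ₄_ne
  have hfpow := hpow.self_of_nhds
  have hf0 : f x ≠ 0 := by
    intro hzero
    simp [hzero, hκ, hF0, hP, hΨ] at hfpow
  have hlog := natCast_mul_logDeriv_of_pow_eq hf hκ hpow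
  rw [logDeriv_div x hF0 (by simp [*]) hF (by fun_prop (disch := assumption)),
    logDeriv_mul x hP (by simp [*]) (by fun_prop) (by fun_prop (disch := assumption)),
    logDeriv_fun_pow (by fun_prop (disch := assumption))] at hlog
  have hderiv := deriv_eq_logDeriv_mul_pullEuler (l := f) hΨ h.deriv_Ψ₄_ne
  have hw := h.logDeriv_Ψ₄_ne
  rw [logDeriv_apply f, hderiv] at hlog
  rw [gauge]
  field_simp at hlog ⊢
  push_cast at hlog
  linear_combination hlog

theorem pulledBackHypEqAt_of_pow_four {a₁ a₂ a₃ b₁ b₂ : ℂ} {θ Y : ℂ → ℂ} (h : RegularPoint x)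
    (hF : QuarticSolutionAt F x) (hf : AnalyticAt ℂ (fun t => Y t / θ t) x) (hκ : κ ≠ 0)
    (hpow : ∀ᶠ y in 𝓝 x, (Y y / θ y) ^ 4 = κ * (F y / (P₄ y * Ψ₄ y ^ k)))
    (hshift : ∀ {z l l₁ l₂ : ℂ},
      HypRiccati (-1 / 28) (3 / 28) (19 / 28) (1 / 2) (3 / 4) z l l₁ l₂ →
        HypRiccati a₁ a₂ a₃ b₁ b₂ z (l - k / 4) l₁ l₂) :
    PulledBackHypEqAt a₁ a₂ a₃ b₁ b₂ Ψ₄ θ Y x := by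
  set l : ℂ → ℂ := fun y => (logDeriv F y / 4 - gauge y) / logDeriv Ψ₄ y
  have hl : AnalyticAt ℂ l x :=
    (((analyticAt_logDeriv hF.analyticAt hF.ne_zero).div_const).sub h.analyticAt_gauge).div
      h.analyticAt_logDeriv_Ψ₄ h.logDeriv_Ψ₄_ne
  have hbase := hF.riccatiAt.hypRiccati h hl (by
    filter_upwards [h.eventually] with y hy
    rw [mul_div_cancel₀ _ hy.logDeriv_Ψ₄_ne]
    ring)
  have hδ : pullEuler Ψ₄ 0 (fun y => l y - k / 4) = pullEuler Ψ₄ 0 l := by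
    funext y
    simp only [pullEuler, pullD, deriv_sub_const, zero_mul]
  refine pulledBackHypEqAt_of_hypRiccati (l := fun y => l y - k / 4) h.analyticAt_Ψ₄ h.Ψ₄_ne
    h.deriv_Ψ₄_ne hf (hl.sub analyticAt_const) ?_ ?_
  · filter_upwards [h.eventually, hF.analyticAt.eventually_analyticAt, hf.eventually_analyticAt,
      hF.analyticAt.continuousAt.eventually_ne hF.ne_zero, hpow.eventually_nhds]
      with y hy hFy hfy hFy0 hpowy
    exact pullEuler_eq_of_pow_four hy hFy.differentiableAt hFy0 hfy.differentiableAt hκ hpowy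
  · rw [hδ]
    exact hshift hbase

theorem quarticSolutionAt_id (h : RegularPoint x) : QuarticSolutionAt (fun y => y) x := by
  refine ⟨analyticAt_id, h.ne_zero, ?_⟩
  obtain ⟨h0, hP, -, -, hR₁, hR₂⟩ := h
  rw [RiccatiAt, derivQuot₂_logDeriv_div_four (F := fun y => y) analyticAt_id h0,
    derivQuot₃_logDeriv_div_four (F := fun y => y) analyticAt_id h0]
  simp only [odeCoeff₂, odeCoeff₁, odeCoeff₀, logDeriv_apply, deriv_id'', deriv_const', deriv_P₄,
    deriv_R₁, deriv_R₂]
  field_simp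
  simp only [P₄, R₁, R₂]
  ring

end QuarticSolutions

section IrrationalSolutions

variable {x ε : ℂ}

/-- The rational part of the fourth powers of the irrational solutions. -/
noncomputable def cub (x : ℂ) : ℂ := 1 - 45 / 64 * x + 5 / 32 * x ^ 2 - 5 / 448 * x ^ 3

/-- The fourth powers of the irrational solutions, for `ε = 1` and `ε = -1`. -/
noncomputable def fourthPow (ε x : ℂ) : ℂ := ε * sqrtR x + cub x

/-- The rational function `a` for which the irrational solutions have logarithmic derivative
`a + b * ε / √(R₁ R₂)` with `b` rational. -/
noncomputable def ratPart (x : ℂ) : ℂ := 1 / 4 / x - 1 / 2 / (5 - x)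

/-- The rational function `b` for which the irrational solutions have logarithmic derivative
`a + b * ε / √(R₁ R₂)` with `a` rational. -/
noncomputable def irrPart (x : ℂ) : ℂ :=
  -1 / 4 / x - 1 / 448 / (5 - x) + (45 / 448 - 5 / 448 * x)

@[fun_prop]
theorem analyticAt_cub (x : ℂ) : AnalyticAt ℂ cub x := by
  unfold cub
  fun_prop

@[fun_prop]
theorem analyticAt_sqrtR (h : R₁ x * R₂ x ∈ Complex.slitPlane) : AnalyticAt ℂ sqrtR x :=
  ((analyticAt_R₁ x).fun_mul (analyticAt_R₂ x)).cpow analyticAt_const h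

@[fun_prop]
theorem analyticAt_fourthPow (h : R₁ x * R₂ x ∈ Complex.slitPlane) :
    AnalyticAt ℂ (fourthPow ε) x := by
  unfold fourthPow
  fun_prop (disch := assumption)

theorem sqrtR_zero : sqrtR 0 = 1 := by simp [sqrtR, R₁, R₂]

theorem sqrtR_sq (x : ℂ) : sqrtR x ^ 2 = R₁ x * R₂ x := by simp [sqrtR]

theorem sqrtR_ne (h : RegularPoint x) : sqrtR x ≠ 0 := by
  simp [sqrtR, h.R₁_ne, h.R₂_ne]

theorem div_sqrtR_sq (hε : ε ^ 2 = 1) (x : ℂ) : (ε / sqrtR x) ^ 2 = 1 / (R₁ x * R₂ x) := by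
  rw [div_pow, hε, sqrtR_sq]

theorem sqrtR_sq_sub_cub_sq (x : ℂ) :
    sqrtR x ^ 2 - cub x ^ 2 = 625 / 28672 * x ^ 2 * (1 - x / 5) ^ 4 := by
  rw [sqrtR_sq]
  simp only [R₁, R₂, cub]
  ring

theorem fourthPow_ne (hε : ε ^ 2 = 1) (h0 : x ≠ 0) (h5 : 5 - x ≠ 0) : fourthPow ε x ≠ 0 := by
  intro hzero
  -- `ε √(R₁ R₂) + cub` divides the norm, whose only zeros are `0` and `5`.
  have h5' : 1 - x / 5 ≠ 0 := by
    contrapose! h5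
    linear_combination 5 * h5
  have hne : 625 / 28672 * x ^ 2 * (1 - x / 5) ^ 4 ≠ 0 := by simp [h0, h5']
  rw [fourthPow] at hzero
  refine hne ?_
  rw [← sqrtR_sq_sub_cub_sq]
  linear_combination (ε * sqrtR x - cub x) * hzero - sqrtR x ^ 2 * hε

theorem deriv_cub (x : ℂ) : deriv cub x = -45 / 64 + 5 / 16 * x - 15 / 448 * x ^ 2 := by
  unfold cub
  simp (disch := fun_prop) only [deriv_fun_add, deriv_fun_sub, deriv_fun_mul, deriv_fun_pow,
    deriv_const_mul_id', deriv_const', deriv_id'', Nat.cast_ofNat, Nat.add_one_sub_one]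
  ring

theorem analyticAt_ratPart (h0 : x ≠ 0) (h5 : 5 - x ≠ 0) : AnalyticAt ℂ ratPart x := by
  unfold ratPart
  fun_prop (disch := assumption)

theorem analyticAt_irrPart (h0 : x ≠ 0) (h5 : 5 - x ≠ 0) : AnalyticAt ℂ irrPart x := by
  unfold irrPart
  fun_prop (disch := assumption)

theorem deriv_ratPart (h0 : x ≠ 0) (h5 : 5 - x ≠ 0) :
    deriv ratPart x = -(1 / 4) / x ^ 2 - 1 / 2 / (5 - x) ^ 2 := by
  have h := (hasDerivAt_const_div_id_pow (1 / 4) 1 h0).fun_sub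
    (hasDerivAt_const_div_sub_pow (1 / 2) 5 1 h5)
  simp only [pow_one] at h
  unfold ratPart
  rw [h.deriv, Nat.cast_one]
  ring

theorem eventually_ne_zero_and_five_sub_ne (h0 : x ≠ 0) (h5 : 5 - x ≠ 0) :
    ∀ᶠ y in 𝓝 x, y ≠ 0 ∧ 5 - y ≠ 0 :=
  (eventually_ne_nhds h0).and ((continuous_const.sub continuous_id).continuousAt.eventually_ne h5)

theorem deriv_deriv_ratPart (h0 : x ≠ 0) (h5 : 5 - x ≠ 0) :
    deriv (deriv ratPart) x = 1 / 2 / x ^ 3 - 1 / (5 - x) ^ 3 := by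
  have hderiv : deriv ratPart =ᶠ[𝓝 x] fun y => -(1 / 4) / y ^ 2 - 1 / 2 / (5 - y) ^ 2 := by
    filter_upwards [eventually_ne_zero_and_five_sub_ne h0 h5] with y hy
    exact deriv_ratPart hy.1 hy.2
  rw [hderiv.deriv_eq, ((hasDerivAt_const_div_id_pow _ 2 h0).fun_sub
    (hasDerivAt_const_div_sub_pow _ 5 2 h5)).deriv]
  norm_num

theorem deriv_irrPart (h0 : x ≠ 0) (h5 : 5 - x ≠ 0) :
    deriv irrPart x = 1 / 4 / x ^ 2 - 1 / 448 / (5 - x) ^ 2 - 5 / 448 := by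
  have h := ((hasDerivAt_const_div_id_pow (-1 / 4) 1 h0).fun_sub
    (hasDerivAt_const_div_sub_pow (1 / 448) 5 1 h5)).fun_add
    (((hasDerivAt_id' x).const_mul (5 / 448)).const_sub (45 / 448))
  simp only [pow_one] at h
  unfold irrPart
  rw [h.deriv, Nat.cast_one]
  ring

theorem deriv_deriv_irrPart (h0 : x ≠ 0) (h5 : 5 - x ≠ 0) :
    deriv (deriv irrPart) x = -(1 / 2) / x ^ 3 - 1 / 224 / (5 - x) ^ 3 := by
  have hderiv : deriv irrPart =ᶠ[𝓝 x]
      fun y => 1 / 4 / y ^ 2 - 1 / 448 / (5 - y) ^ 2 - 5 / 448 := by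
    filter_upwards [eventually_ne_zero_and_five_sub_ne h0 h5] with y hy
    exact deriv_irrPart hy.1 hy.2
  rw [hderiv.deriv_eq, (((hasDerivAt_const_div_id_pow _ 2 h0).fun_sub
    (hasDerivAt_const_div_sub_pow _ 5 2 h5)).sub_const _).deriv]
  norm_num

/-- The logarithmic derivative of `√(R₁ R₂)`. -/
noncomputable def logDerivSqrtR (x : ℂ) : ℂ := (logDeriv R₁ x + logDeriv R₂ x) / 2

theorem RegularPoint.analyticAt_logDerivSqrtR (h : RegularPoint x) :
    AnalyticAt ℂ logDerivSqrtR x := by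
  obtain ⟨-, -, -, -, hR₁, hR₂⟩ := h
  unfold logDerivSqrtR
  fun_prop (disch := assumption)

theorem RegularPoint.logDeriv_sqrtR (h : RegularPoint x) (hR : R₁ x * R₂ x ∈ Complex.slitPlane) :
    logDeriv sqrtR x = logDerivSqrtR x := by
  have hlog := natCast_mul_logDeriv_of_pow_eq (analyticAt_sqrtR hR).differentiableAt one_ne_zero
    (.of_forall fun y => (sqrtR_sq y).trans (one_mul _).symm)
  rw [logDeriv_mul x h.R₁_ne h.R₂_ne (by fun_prop) (by fun_prop)] at hlog
  rw [logDerivSqrtR, ← hlog]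
  norm_num

theorem RegularPoint.deriv_logDerivSqrtR (h : RegularPoint x) :
    deriv logDerivSqrtR x =
      (deriv (deriv R₁) x / R₁ x - logDeriv R₁ x ^ 2 +
        (deriv (deriv R₂) x / R₂ x - logDeriv R₂ x ^ 2)) / 2 := by
  obtain ⟨-, -, -, -, hR₁, hR₂⟩ := h
  unfold logDerivSqrtR
  rw [deriv_div_const, deriv_fun_add (by fun_prop (disch := assumption))
    (by fun_prop (disch := assumption)),
    (eventuallyEq_deriv_logDeriv (analyticAt_R₁ x) hR₁).eq_of_nhds,
    (eventuallyEq_deriv_logDeriv (analyticAt_R₂ x) hR₂).eq_of_nhds]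

theorem deriv_const_div_sqrtR (h : RegularPoint x) (hR : R₁ x * R₂ x ∈ Complex.slitPlane) :
    deriv (fun y => ε / sqrtR y) x = -logDerivSqrtR x * (ε / sqrtR x) := by
  have hS := sqrtR_ne h
  rw [deriv_fun_div (by fun_prop) (by fun_prop (disch := assumption)) hS, deriv_const,
    ← h.logDeriv_sqrtR hR, logDeriv_apply]
  field_simp
  ring

theorem analyticAt_const_div_sqrtR (h : RegularPoint x)
    (hR : R₁ x * R₂ x ∈ Complex.slitPlane) : AnalyticAt ℂ (fun y => ε / sqrtR y) x :=
  analyticAt_const.fun_div (analyticAt_sqrtR hR) (sqrtR_ne h)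

theorem deriv_deriv_const_div_sqrtR (h : RegularPoint x)
    (hR : R₁ x * R₂ x ∈ Complex.slitPlane) :
    deriv (deriv fun y => ε / sqrtR y) x =
      (logDerivSqrtR x ^ 2 - deriv logDerivSqrtR x) * (ε / sqrtR x) := by
  have hderiv : deriv (fun y => ε / sqrtR y) =ᶠ[𝓝 x]
      fun y => -logDerivSqrtR y * (ε / sqrtR y) := by
    filter_upwards [h.eventually, eventually_mem_slitPlane
      ((analyticAt_R₁ x).fun_mul (analyticAt_R₂ x)).continuousAt hR]
      with y hy hRy using deriv_const_div_sqrtR hy hRy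
  rw [hderiv.deriv_eq, deriv_fun_mul h.analyticAt_logDerivSqrtR.differentiableAt.fun_neg
    (analyticAt_const_div_sqrtR h hR).differentiableAt, deriv.fun_neg, deriv_const_div_sqrtR h hR]
  ring

theorem riccati_rational_part (h : RegularPoint x) (h5 : 5 - x ≠ 0) :
    derivQuot₃ ratPart x + 3 * ratPart x * (irrPart x ^ 2 / (R₁ x * R₂ x)) +
      3 * irrPart x * (deriv irrPart x - irrPart x * logDerivSqrtR x) / (R₁ x * R₂ x) +
      odeCoeff₂ x * (derivQuot₂ ratPart x + irrPart x ^ 2 / (R₁ x * R₂ x)) +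
      odeCoeff₁ x * ratPart x + odeCoeff₀ x = 0 := by
  obtain ⟨h0, hP, -, -, hR₁, hR₂⟩ := h
  simp only [derivQuot₃, derivQuot₂, deriv_ratPart h0 h5, deriv_deriv_ratPart h0 h5,
    deriv_irrPart h0 h5, logDerivSqrtR, odeCoeff₂, odeCoeff₁, odeCoeff₀, ratPart, irrPart,
    logDeriv_apply]
  field_simp
  simp only [deriv_P₄, deriv_R₁, deriv_R₂, P₄, R₁, R₂]
  ring

theorem riccati_irrational_part (h : RegularPoint x) (h5 : 5 - x ≠ 0) :
    deriv (deriv irrPart) x - 2 * deriv irrPart x * logDerivSqrtR x +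
      irrPart x * (logDerivSqrtR x ^ 2 - deriv logDerivSqrtR x) +
      irrPart x ^ 3 / (R₁ x * R₂ x) + 3 * derivQuot₂ ratPart x * irrPart x +
      3 * ratPart x * (deriv irrPart x - irrPart x * logDerivSqrtR x) +
      odeCoeff₂ x *
        (deriv irrPart x - irrPart x * logDerivSqrtR x + 2 * ratPart x * irrPart x) +
      odeCoeff₁ x * irrPart x = 0 := by
  rw [h.deriv_logDerivSqrtR]
  obtain ⟨h0, hP, -, -, hR₁, hR₂⟩ := h
  simp only [derivQuot₂, deriv_ratPart h0 h5, deriv_irrPart h0 h5, deriv_deriv_irrPart h0 h5,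
    logDerivSqrtR, odeCoeff₂, odeCoeff₁, ratPart, irrPart, logDeriv_apply]
  field_simp
  simp only [deriv_P₄, deriv_R₁, deriv_deriv_R₁, deriv_R₂, deriv_deriv_R₂, P₄, R₁, R₂]
  ring

theorem derivQuot₂_irrPart_mul (hε : ε ^ 2 = 1) (h : RegularPoint x)
    (hR : R₁ x * R₂ x ∈ Complex.slitPlane) (h5 : 5 - x ≠ 0) :
    derivQuot₂ (fun y => irrPart y * (ε / sqrtR y)) x =
      (deriv irrPart x - irrPart x * logDerivSqrtR x) * (ε / sqrtR x) +
        irrPart x ^ 2 / (R₁ x * R₂ x) := by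
  rw [derivQuot₂, deriv_fun_mul (analyticAt_irrPart h.ne_zero h5).differentiableAt
    (analyticAt_const_div_sqrtR h hR).differentiableAt, deriv_const_div_sqrtR h hR]
  linear_combination irrPart x ^ 2 * div_sqrtR_sq hε x

theorem derivQuot₃_irrPart_mul (hε : ε ^ 2 = 1) (h : RegularPoint x)
    (hR : R₁ x * R₂ x ∈ Complex.slitPlane) (h5 : 5 - x ≠ 0) :
    derivQuot₃ (fun y => irrPart y * (ε / sqrtR y)) x =
      3 * irrPart x * (deriv irrPart x - irrPart x * logDerivSqrtR x) / (R₁ x * R₂ x) +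
        (deriv (deriv irrPart) x - 2 * deriv irrPart x * logDerivSqrtR x +
          irrPart x * (logDerivSqrtR x ^ 2 - deriv logDerivSqrtR x) +
          irrPart x ^ 3 / (R₁ x * R₂ x)) * (ε / sqrtR x) := by
  have hb := analyticAt_irrPart h.ne_zero h5
  have hu := analyticAt_const_div_sqrtR (ε := ε) h hR
  rw [derivQuot₃, deriv_deriv_fun_mul hb hu, deriv_deriv_const_div_sqrtR h hR,
    deriv_fun_mul hb.differentiableAt hu.differentiableAt, deriv_const_div_sqrtR h hR]
  linear_combination (3 * irrPart x * (deriv irrPart x - irrPart x * logDerivSqrtR x) +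
    irrPart x ^ 3 * (ε / sqrtR x)) * div_sqrtR_sq hε x

theorem riccatiAt_ratPart_add_irrPart_mul (hε : ε ^ 2 = 1) (h : RegularPoint x)
    (hR : R₁ x * R₂ x ∈ Complex.slitPlane) (h5 : 5 - x ≠ 0) :
    RiccatiAt (fun y => ratPart y + irrPart y * (ε / sqrtR y)) x := by
  have ha := analyticAt_ratPart h.ne_zero h5
  have hbu := (analyticAt_irrPart h.ne_zero h5).fun_mul (analyticAt_const_div_sqrtR (ε := ε) h hR)
  rw [RiccatiAt, derivQuot₂_add ha.differentiableAt hbu.differentiableAt, derivQuot₃_add ha hbu,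
    derivQuot₂_irrPart_mul hε h hR h5, derivQuot₃_irrPart_mul hε h hR h5]
  linear_combination riccati_rational_part h h5 + ε / sqrtR x * riccati_irrational_part h h5

theorem deriv_cub_eq (h0 : x ≠ 0) (h5 : 5 - x ≠ 0) :
    deriv cub x = 4 * ratPart x * cub x + 4 * irrPart x := by
  rw [deriv_cub, ratPart, irrPart, cub]
  field_simp
  ring

theorem logDerivSqrtR_mul (h : RegularPoint x) (h5 : 5 - x ≠ 0) :
    logDerivSqrtR x * (R₁ x * R₂ x) =
      4 * ratPart x * (R₁ x * R₂ x) + 4 * irrPart x * cub x := by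
  obtain ⟨h0, -, -, -, hR₁, hR₂⟩ := h
  simp only [logDerivSqrtR, logDeriv_apply, ratPart, irrPart]
  field_simp
  simp only [deriv_R₁, deriv_R₂, R₁, R₂, cub]
  ring

theorem logDeriv_fourthPow_div_four (hε : ε ^ 2 = 1) (h : RegularPoint x)
    (hR : R₁ x * R₂ x ∈ Complex.slitPlane) (h5 : 5 - x ≠ 0) :
    logDeriv (fourthPow ε) x / 4 = ratPart x + irrPart x * (ε / sqrtR x) := by
  have hS := sqrtR_ne h
  have hF := fourthPow_ne hε h.ne_zero h5
  have hR' := logDerivSqrtR_mul h h5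
  have hS' : deriv sqrtR x = logDerivSqrtR x * sqrtR x := by
    rw [← h.logDeriv_sqrtR hR, logDeriv_apply, div_mul_cancel₀ _ hS]
  have hF' : deriv (fourthPow ε) x = ε * (logDerivSqrtR x * sqrtR x) + deriv cub x := by
    unfold fourthPow
    rw [deriv_fun_add (by fun_prop (disch := assumption)) (by fun_prop),
      deriv_const_mul_field, hS']
  rw [← sqrtR_sq] at hR'
  rw [logDeriv_apply, hF', deriv_cub_eq h.ne_zero h5]
  rw [fourthPow] at hF ⊢
  field_simp
  linear_combination ε * hR' - 4 * irrPart x * sqrtR x * hε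

theorem quarticSolutionAt_fourthPow (hε : ε ^ 2 = 1) (h : RegularPoint x)
    (hR : R₁ x * R₂ x ∈ Complex.slitPlane) (h5 : 5 - x ≠ 0) :
    QuarticSolutionAt (fourthPow ε) x := by
  refine ⟨analyticAt_fourthPow hR, fourthPow_ne hε h.ne_zero h5,
    (riccatiAt_ratPart_add_irrPart_mul hε h hR h5).congr ?_⟩
  filter_upwards [h.eventually, eventually_ne_zero_and_five_sub_ne h.ne_zero h5,
    eventually_mem_slitPlane
      ((analyticAt_R₁ x).fun_mul (analyticAt_R₂ x)).continuousAt hR]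
    with y hy hy5 hRy using (logDeriv_fourthPow_div_four hε hy hRy hy5.2).symm

end IrrationalSolutions

section NearZero

variable {x : ℂ}

theorem fourthPow_one_zero : fourthPow 1 0 = 2 := by
  rw [fourthPow, sqrtR_zero, cub]
  norm_num

theorem eventually_deriv_Ψ₄_ne : ∀ᶠ x in 𝓝 (0 : ℂ), deriv Ψ₄ x ≠ 0 := by
  have hP : P₄ 0 ≠ 0 := by simp [P₄]
  refine (analyticAt_Ψ₄ hP).deriv.continuousAt.eventually_ne ?_
  simp [deriv_Ψ₄ hP, P₄, R₁, Q₄, Q₈]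

theorem eventually_P₄_mem_slitPlane : ∀ᶠ x in 𝓝 (0 : ℂ), P₄ x ∈ Complex.slitPlane :=
  eventually_mem_slitPlane (analyticAt_P₄ 0).continuousAt (by simp [P₄])

theorem eventually_quarticSolutionAt_fourthPow :
    ∀ᶠ x in 𝓝[≠] (0 : ℂ), ∀ ε : ℂ, ε ^ 2 = 1 → QuarticSolutionAt (fourthPow ε) x := by
  have hR : ∀ᶠ x in 𝓝 (0 : ℂ), R₁ x * R₂ x ∈ Complex.slitPlane :=
    eventually_mem_slitPlane ((analyticAt_R₁ 0).fun_mul (analyticAt_R₂ 0)).continuousAt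
      (by simp [R₁, R₂])
  have h5 : ∀ᶠ x in 𝓝 (0 : ℂ), 5 - x ≠ 0 :=
    (continuous_const.sub continuous_id).continuousAt.eventually_ne (by simp)
  filter_upwards [eventually_regularPoint, hR.filter_mono nhdsWithin_le_nhds,
    h5.filter_mono nhdsWithin_le_nhds] with x h hRx h5x ε hε
  exact quarticSolutionAt_fourthPow hε h hRx h5x

theorem K₁_eq (x : ℂ) : K₁ x = (fourthPow 1 x / 2) ^ (1 / 4 : ℂ) := by
  rw [K₁, fourthPow, cub]
  congr 1
  ring

theorem K₁_pow_four (x : ℂ) : K₁ x ^ 4 = fourthPow 1 x / 2 := by simp [K₁_eq]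

theorem analyticAt_K₁_zero : AnalyticAt ℂ K₁ 0 := by
  rw [funext K₁_eq]
  exact ((analyticAt_fourthPow (by simp [R₁, R₂])).fun_div analyticAt_const two_ne_zero).cpow
    analyticAt_const (by simp [fourthPow_one_zero])

theorem K₁_zero : K₁ 0 = 1 := by simp [K₁_eq, fourthPow_one_zero]

theorem K₂_zero : K₂ 0 = 1 := by simp [K₂]

theorem K₂_pow_four (h0 : x ≠ 0) :
    K₂ x ^ 4 = -fourthPow (-1) x / (625 / 57344 * x ^ 2) := by
  have hroot := cpow_natCast_div_pow ((sqrtR x - 1 + 45 / 64 * x - 5 / 32 * x ^ 2 +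
    5 / 448 * x ^ 3) / (625 / 57344 * x ^ 2)) 1 four_ne_zero
  rw [Nat.cast_one, Nat.cast_ofNat, pow_one] at hroot
  rw [K₂, if_neg h0, hroot, fourthPow, cub]
  ring

theorem K₂_eq (h5 : 5 - x ≠ 0) :
    K₂ x = (2 * (1 - x / 5) ^ 4 / fourthPow 1 x) ^ (1 / 4 : ℂ) := by
  rcases eq_or_ne x 0 with rfl | h0
  · simp [K₂_zero, fourthPow_one_zero]
  · have hne : fourthPow 1 x ≠ 0 := fourthPow_ne (by norm_num) h0 h5
    -- Multiplying by the conjugate `fourthPow 1` cancels the factor `x ^ 2` of the denominator.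
    have hnorm := sqrtR_sq_sub_cub_sq x
    rw [K₂, if_neg h0]
    congr 1
    rw [div_eq_div_iff (by simpa using h0) hne, fourthPow]
    rw [cub] at hnorm ⊢
    linear_combination hnorm

theorem analyticAt_K₂_zero : AnalyticAt ℂ K₂ 0 := by
  have hquot : AnalyticAt ℂ (fun x => 2 * (1 - x / 5) ^ 4 / fourthPow 1 x) 0 :=
    AnalyticAt.fun_div (by fun_prop) (analyticAt_fourthPow (by simp [R₁, R₂]))
      (by simp [fourthPow_one_zero])
  refine (hquot.cpow (analyticAt_const (v := (1 / 4 : ℂ)))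
    (by simp [fourthPow_one_zero])).congr ?_
  filter_upwards [(continuous_const.sub continuous_id).continuousAt.eventually_ne
    (show (5 - 0 : ℂ) ≠ 0 by simp)] with x hx using (K₂_eq hx).symm

end NearZero

section Evaluations

variable {a₁ a₂ a₃ b₁ b₂ κ : ℂ} {k : ℕ} {f F : ℂ → ℂ}

theorem hasSum_hypTerm_Ψ₄ (hb₁ : ∀ n : ℕ, b₁ + n ≠ 0) (hb₂ : ∀ n : ℕ, b₂ + n ≠ 0)
    (hf : AnalyticAt ℂ f 0) (hf0 : f 0 = 1) (hF : ∀ᶠ x in 𝓝[≠] 0, QuarticSolutionAt F x)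
    (hκ : κ ≠ 0) (hpow : ∀ x, RegularPoint x → f x ^ 4 = κ * (F x / (P₄ x * Ψ₄ x ^ k)))
    (hshift : ∀ {z l l₁ l₂ : ℂ},
      HypRiccati (-1 / 28) (3 / 28) (19 / 28) (1 / 2) (3 / 4) z l l₁ l₂ →
        HypRiccati a₁ a₂ a₃ b₁ b₂ z (l - k / 4) l₁ l₂) :
    ∀ᶠ x in 𝓝 0, HasSum (hypTerm a₁ a₂ a₃ b₁ b₂ (Ψ₄ x)) (f x) := by
  refine hasSum_hypTerm_of_pulledBackHypEqAt hb₁ hb₂ (analyticAt_Ψ₄ (by simp [P₄]))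
    (by simp [Ψ₄]) eventually_deriv_Ψ₄_ne.self_of_nhds hf hf0 ?_
  filter_upwards [eventually_regularPoint, hF,
    hf.eventually_analyticAt.filter_mono nhdsWithin_le_nhds] with x h hFx hfx
  refine pulledBackHypEqAt_of_pow_four h hFx (by simpa using hfx) hκ ?_ hshift
  filter_upwards [h.eventually] with y hy
  rw [div_one, hpow y hy]

theorem analyticAt_P₄_cpow (a : ℂ) {x : ℂ} (h : P₄ x ∈ Complex.slitPlane) :
    AnalyticAt ℂ (fun y => P₄ y ^ a) x :=
  (analyticAt_P₄ x).cpow analyticAt_const h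

theorem hasSum_hypTerm_Ψ₄_K₁_div : ∀ᶠ x in 𝓝 (0 : ℂ),
    HasSum (hypTerm (-1 / 28) (3 / 28) (19 / 28) (1 / 2) (3 / 4) (Ψ₄ x))
      (K₁ x / P₄ x ^ (1 / 4 : ℂ)) := by
  have hF : ∀ᶠ x in 𝓝[≠] (0 : ℂ), QuarticSolutionAt (fourthPow 1) x :=
    eventually_quarticSolutionAt_fourthPow.mono fun x hx => hx 1 (by norm_num)
  refine hasSum_hypTerm_Ψ₄ (κ := 1 / 2) (k := 0) (fun n => ?_) (fun n => ?_)
    (analyticAt_K₁_zero.fun_div (analyticAt_P₄_cpow _ (by simp [P₄])) (by simp [P₄]))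
    (by simp [K₁_zero, P₄]) hF (by norm_num) (fun x _ => ?_) (fun h => by simpa using h)
  · simpa using ofReal_add_natCast_ne_zero (q := 1 / 2) (by norm_num) n
  · simpa using ofReal_add_natCast_ne_zero (q := 3 / 4) (by norm_num) n
  · have hP := cpow_natCast_div_pow (P₄ x) 1 four_ne_zero
    norm_num at hP
    rw [div_pow, K₁_pow_four, hP]
    ring

theorem hasSum_hypTerm_Ψ₄_div_sqrt_R₁ : ∀ᶠ x in 𝓝 (0 : ℂ),
    HasSum (hypTerm (3 / 14) (5 / 14) (13 / 14) (3 / 4) (5 / 4) (Ψ₄ x))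
      (P₄ x ^ (3 / 2 : ℂ) / (Q₄ x * R₁ x ^ (1 / 2 : ℂ))) := by
  refine hasSum_hypTerm_Ψ₄ (κ := -343 / 32) (k := 1) (fun n => ?_) (fun n => ?_)
    ((analyticAt_P₄_cpow _ (by simp [P₄])).fun_div ((analyticAt_Q₄ 0).fun_mul
      ((analyticAt_R₁ 0).cpow analyticAt_const (by simp [R₁]))) (by simp [Q₄, R₁]))
    (by simp [P₄, Q₄, R₁]) (eventually_regularPoint.mono fun x hx => quarticSolutionAt_id hx)
    (by norm_num) (fun x hx => ?_) (fun h => by convert h.shift_right using 1 <;> norm_num)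
  · simpa using ofReal_add_natCast_ne_zero (q := 3 / 4) (by norm_num) n
  · simpa using ofReal_add_natCast_ne_zero (q := 5 / 4) (by norm_num) n
  · have hP := cpow_natCast_div_pow (P₄ x) 6 four_ne_zero
    have hR := cpow_natCast_div_pow (R₁ x) 2 four_ne_zero
    norm_num at hP hR
    obtain ⟨h0, hP0, hQ₄, -, hR₁, -⟩ := hx
    rw [div_pow, mul_pow, hP, hR, Ψ₄_eq hP0]
    field_simp

theorem hasSum_hypTerm_Ψ₄_mul_K₂ : ∀ᶠ x in 𝓝 (0 : ℂ),
    HasSum (hypTerm (13 / 28) (17 / 28) (33 / 28) (5 / 4) (3 / 2) (Ψ₄ x))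
      (P₄ x ^ (13 / 4 : ℂ) * K₂ x / (Q₄ x ^ 2 * R₁ x)) := by
  have hF : ∀ᶠ x in 𝓝[≠] (0 : ℂ), QuarticSolutionAt (fourthPow (-1)) x :=
    eventually_quarticSolutionAt_fourthPow.mono fun x hx => hx (-1) (by norm_num)
  refine hasSum_hypTerm_Ψ₄ (κ := -(343 / 32) ^ 2 / (625 / 57344)) (k := 2)
    (fun n => ?_) (fun n => ?_)
    (((analyticAt_P₄_cpow _ (by simp [P₄])).fun_mul analyticAt_K₂_zero).fun_div
      (((analyticAt_Q₄ 0).fun_pow 2).fun_mul (analyticAt_R₁ 0)) (by simp [Q₄, R₁]))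
    (by simp [P₄, Q₄, R₁, K₂_zero]) hF (by norm_num) (fun x hx => ?_)
    (fun h => by convert h.shift_left using 1 <;> norm_num)
  · simpa using ofReal_add_natCast_ne_zero (q := 5 / 4) (by norm_num) n
  · simpa using ofReal_add_natCast_ne_zero (q := 3 / 2) (by norm_num) n
  · have hP := cpow_natCast_div_pow (P₄ x) 13 four_ne_zero
    norm_num at hP
    obtain ⟨h0, hP0, hQ₄, -, hR₁, -⟩ := hx
    rw [div_pow, mul_pow, hP, K₂_pow_four h0, Ψ₄_eq hP0]
    field_simp

end Evaluations

theorem pulledBackHypEqAt_Ψ₄_of_pow_four_eq {F Y : ℂ → ℂ} {x : ℂ} (h : RegularPoint x)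
    (hP : P₄ x ∈ Complex.slitPlane) (hF : QuarticSolutionAt F x) (hY : AnalyticAt ℂ Y x)
    (hYF : ∀ᶠ y in 𝓝 x, Y y ^ 4 = F y) :
    PulledBackHypEqAt (-1 / 28) (3 / 28) (19 / 28) (1 / 2) (3 / 4) Ψ₄
      (fun t => P₄ t ^ (1 / 4 : ℂ)) Y x := by
  refine pulledBackHypEqAt_of_pow_four (k := 0) h hF
    (hY.fun_div (analyticAt_P₄_cpow _ hP) (by simp [h.P₄_ne])) one_ne_zero ?_
    (fun h => by simpa using h)
  filter_upwards [hYF] with y hy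
  have hP := cpow_natCast_div_pow (P₄ y) 1 four_ne_zero
  norm_num at hP
  rw [div_pow, hy, hP, pow_zero, mul_one, one_mul]

theorem eventually_pulledBackHypEqAt_Ψ₄ : ∀ᶠ x in 𝓝[≠] (0 : ℂ), ∀ Y : ℂ → ℂ, AnalyticAt ℂ Y x →
    ((∀ᶠ y in 𝓝 x, Y y ^ 4 = y) ∨ ∃ ε : ℂ, ε ^ 2 = 1 ∧ ∀ᶠ y in 𝓝 x, Y y ^ 4 = fourthPow ε y) →
      PulledBackHypEqAt (-1 / 28) (3 / 28) (19 / 28) (1 / 2) (3 / 4) Ψ₄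
        (fun t => P₄ t ^ (1 / 4 : ℂ)) Y x := by
  filter_upwards [eventually_regularPoint, eventually_quarticSolutionAt_fourthPow,
    eventually_P₄_mem_slitPlane.filter_mono nhdsWithin_le_nhds] with x h hF hP Y hY hY4
  obtain hid | ⟨ε, hε, hfour⟩ := hY4
  · exact pulledBackHypEqAt_Ψ₄_of_pow_four_eq h hP (quarticSolutionAt_id h) hY hid
  · exact pulledBackHypEqAt_Ψ₄_of_pow_four_eq h hP (hF ε hε) hY hfour

end Darboux

theorem mainTheorem2 :
    -- the two factorizations of the covering
    (∀ x : ℂ, P₄ x ≠ 0 →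
      Ψ₄ x = -(343 * x * R₁ x ^ 2 * Q₄ x ^ 4) / (32 * P₄ x ^ 7) ∧
      Ψ₄ x = 1 - R₂ x * Q₈ x ^ 2 / P₄ x ^ 7) ∧
    -- both fourth roots are analytic at 0 with value 1
    (AnalyticAt ℂ K₁ 0 ∧ K₁ 0 = 1) ∧
    (AnalyticAt ℂ K₂ 0 ∧ K₂ 0 = 1) ∧
    -- the three evaluations in a neighbourhood of 0, where the three series converge
    (∀ᶠ x in 𝓝 (0 : ℂ),
      (Summable (hypTerm (-1 / 28) (3 / 28) (19 / 28) (1 / 2) (3 / 4) (Ψ₄ x)) ∧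
        hyp (-1 / 28) (3 / 28) (19 / 28) (1 / 2) (3 / 4) (Ψ₄ x) =
          K₁ x / P₄ x ^ (1 / 4 : ℂ)) ∧
      (Summable (hypTerm (3 / 14) (5 / 14) (13 / 14) (3 / 4) (5 / 4) (Ψ₄ x)) ∧
        hyp (3 / 14) (5 / 14) (13 / 14) (3 / 4) (5 / 4) (Ψ₄ x) =
          P₄ x ^ (3 / 2 : ℂ) / (Q₄ x * R₁ x ^ (1 / 2 : ℂ))) ∧
      (Summable (hypTerm (13 / 28) (17 / 28) (33 / 28) (5 / 4) (3 / 2) (Ψ₄ x)) ∧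
        hyp (13 / 28) (17 / 28) (33 / 28) (5 / 4) (3 / 2) (Ψ₄ x) =
          P₄ x ^ (13 / 4 : ℂ) * K₂ x / (Q₄ x ^ 2 * R₁ x))) ∧
    -- every local branch of the three fourth roots solves the pulled-back equation
    (∃ r : ℝ, 0 < r ∧ (∀ x ∈ Metric.ball (0 : ℂ) r, deriv Ψ₄ x ≠ 0) ∧
      ∀ U : Set ℂ, IsOpen U → U ⊆ Metric.ball 0 r \ {0} →
      ∀ Y : ℂ → ℂ, DifferentiableOn ℂ Y U →
        ((∀ x ∈ U, Y x ^ 4 = x) ∨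
          (∀ x ∈ U, Y x ^ 4 =
            sqrtR x + 1 - 45 / 64 * x + 5 / 32 * x ^ 2 - 5 / 448 * x ^ 3) ∨
          (∀ x ∈ U, Y x ^ 4 =
            -sqrtR x + 1 - 45 / 64 * x + 5 / 32 * x ^ 2 - 5 / 448 * x ^ 3)) →
        ∀ x ∈ U,
          PulledBackHypEqAt (-1 / 28) (3 / 28) (19 / 28) (1 / 2) (3 / 4)
            Ψ₄ (fun t => P₄ t ^ (1 / 4 : ℂ)) Y x) := by
  have hseries {a₁ a₂ a₃ b₁ b₂ z s : ℂ} (h : HasSum (hypTerm a₁ a₂ a₃ b₁ b₂ z) s) :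
      Summable (hypTerm a₁ a₂ a₃ b₁ b₂ z) ∧ hyp a₁ a₂ a₃ b₁ b₂ z = s := ⟨h.summable, h.tsum_eq⟩
  refine ⟨fun x hx => ⟨Ψ₄_eq hx, by rw [← one_sub_Ψ₄ hx, sub_sub_cancel]⟩,
    ⟨analyticAt_K₁_zero, K₁_zero⟩, ⟨analyticAt_K₂_zero, K₂_zero⟩, ?_, ?_⟩
  · filter_upwards [hasSum_hypTerm_Ψ₄_K₁_div, hasSum_hypTerm_Ψ₄_div_sqrt_R₁,
      hasSum_hypTerm_Ψ₄_mul_K₂] with x h₁ h₂ h₃ using ⟨hseries h₁, hseries h₂, hseries h₃⟩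
  · obtain ⟨r, hr, hball⟩ := Metric.eventually_nhds_iff_ball.1
      (eventually_deriv_Ψ₄_ne.and (eventually_nhdsWithin_iff.1 eventually_pulledBackHypEqAt_Ψ₄))
    refine ⟨r, hr, fun x hx => (hball x hx).1, fun U hU hUr Y hY hY4 x hx => ?_⟩
    have hnhds := hU.eventually_mem hx
    refine (hball x (hUr hx).1).2 (hUr hx).2 Y (hY.analyticAt hnhds) ?_
    rcases hY4 with h | h | h
    · exact .inl (hnhds.mono h)
    · refine .inr ⟨1, by norm_num, hnhds.mono fun y hy => ?_⟩
      rw [h y hy, fourthPow, cub]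
      ring
    · refine .inr ⟨-1, by norm_num, hnhds.mono fun y hy => ?_⟩
      rw [h y hy, fourthPow, cub]
      ring
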